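/- Let $k,n\ge 1$. For $x\in\mathbb R^n$ and real numbers $u_I$, indexed by the multi-indices $I\in\mathbb N_0^n$ with $|I|\le k$, the tuple $(x,(u_I)_{|I|\le k})$ is the global coordinate description of the $k$-jet at $x$ of the functions $f$ with $\partial_I f(x)=u_I$ for $|I|\le k$; the jet space $J^k(\mathbb R^n)$ is the space of all these tuples. Put $$X_i=\partial_{x_i}+\sum_{|I|<k}u_{I+e_i}\,\partial_{u_I}\qquad(1\le i\le n).$$ The horizontal subbundle is spanned by $X_1,\dots,X_n$ and by the $\partial_{u_I}$ with $|I|=k$. Let $g_0$ be the Riemannian metric for which $(X_1,\dots,X_n,\partial_{u_I})_{|I|\le k}$ is an orthonormal frame, and let $d_c$ be the Carnot–Carathéodory distance: $d_c(p,q)$ is the infimum of the $g_0$-lengths of the horizontal $C^1$ curves joining $p$ to $q$. For $L>0$ let $\delta_L(x,(u_I))=(Lx,(L^{k+1-|I|}u_I))$. For a set $\Gamma\subset J^k(\mathbb R^n)$ and $c\in\Gamma$ let $e_c$ be the corresponding unit vector in $\ell^2(\Gamma)$. For $\varepsilon>0$ let $\Sigma(\Gamma,\varepsilon,n)$ be the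 complex formed by the simplices $[e_{a_1},\dots,e_{a_m}]\subset\ell^2(\Gamma)$ (convex hulls) with $1\le m\le n+1$, $a_1,\dots,a_m\in\Gamma$ and $d_c(a_i,a_j)\le\varepsilon$ for all $i,j$; each simplex carries the restricted metric of $\ell^2(\Gamma)$. A map on $\Sigma(\Gamma,\varepsilon,n)$ is a map on the union of its simplices. **Proposition.** Let $k,n\ge1$ and $r\ge2$ be integers and let $\varepsilon\ge\varepsilon'>0$. Then there exist subsets $A,A'\subset J^k(\mathbb R^n)$ that are discrete (without accumulation point in $J^k(\mathbb R^n)$) and $\varepsilon'$-dense with respect to $d_c$ (every point of $J^k(\mathbb R^n)$ is at $d_c$-distance at most $\varepsilon'$ from a point of $A$, and from a point of $A'$), and maps $$F:\Sigma(\Gamma,\varepsilon,n)\to J^k(\mathbb R^n),\qquad F':\Sigma(\Gamma',\varepsilon,n)\to J^k(\mathbb R^n),$$ where $\Gamma=A\cup\delta_r(A')$ and $\Gamma'=A'\cup\delta_r(A)$, with the following properties. 1. $F(e_c)=c$ for all $c\in\Gamma$ and $F'(e_{c'})=c'$ for all $c'\in\Gamma'$. 2. For $1\le m\le n+1$ and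 $a_1,\dots,a_m\in A$ with $d_c(a_i,a_j)\le\varepsilon/r$ for all $i,j$, $$F'\Big(\sum_i t_i e_{\delta_r(a_i)}\Big)=\delta_r\Big(F\Big(\sum_i t_i e_{a_i}\Big)\Big)\quad\text{for all } t_i\ge0,\ \sum_i t_i=1;$$ similarly, for $a'_1,\dots,a'_m\in A'$ with $d_c(a'_i,a'_j)\le\varepsilon/r$ for all $i,j$, $$F\Big(\sum_i t_i e_{\delta_r(a'_i)}\Big)=\delta_r\Big(F'\Big(\sum_i t_i e_{a'_i}\Big)\Big)\quad\text{for all } t_i\ge0,\ \sum_i t_i=1.$$ 3. There is a constant $\varrho\ge 0$ such that the restriction of $F$ to every simplex of $\Sigma(\Gamma,\varepsilon,n)$ and the restriction of $F'$ to every simplex of $\Sigma(\Gamma',\varepsilon,n)$ is $\varrho$-Lipschitz with respect to the $\ell^2$-metric on the simplex and $d_c$ on $J^k(\mathbb R^n)$. -/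

import Mathlib

open scoped ENNReal NNReal

noncomputable section

namespace JetCarnot

/-- Multi-indices `I = (i₁, …, iₙ)` with `|I| = i₁ + ⋯ + iₙ ≤ k`. -/
abbrev MultiIndex (n k : ℕ) : Type := {I : Fin n → ℕ // ∑ i, I i ≤ k}

instance (n k : ℕ) : Fintype (MultiIndex n k) :=
  Fintype.subtype
    ((Fintype.piFinset fun _ : Fin n => Finset.range (k + 1)).filter fun I => ∑ i, I i ≤ k) <| by
    intro I
    simp only [Finset.mem_filter, Fintype.mem_piFinset, Finset.mem_range, and_iff_right_iff_imp]
    intro h i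
    have := Finset.single_le_sum (f := I) (fun j _ => Nat.zero_le _) (Finset.mem_univ i)
    omega

/-- The order `|I|` of a multi-index. -/
def MultiIndex.order {n k : ℕ} (I : MultiIndex n k) : ℕ := ∑ i, I.1 i

/-- The multi-index `I + e_i`, for `|I| < k`. -/
def MultiIndex.succ {n k : ℕ} (I : MultiIndex n k) (h : I.order < k) (i : Fin n) :
    MultiIndex n k :=
  ⟨I.1 + Pi.single i 1, by
    have h' : ∑ j, I.1 j < k := h
    simp only [Pi.add_apply, Finset.sum_add_distrib, Finset.sum_pi_single', Finset.mem_univ,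
      if_true]
    omega⟩

/-- The jet space `J^k(ℝⁿ)` in its global coordinates: the point `(x, u)` is the `k`-jet at `x`
of the functions `f` with `∂_I f (x) = u_I` for all `|I| ≤ k`. As a manifold it is a finite
dimensional vector space, so the same type serves for its tangent spaces. The product norm that
the type carries is used for its differentiable structure only. -/
abbrev JetSpace (n k : ℕ) : Type := (Fin n → ℝ) × (MultiIndex n k → ℝ)

variable {n k : ℕ}

/-- The vector field `X_i = ∂_{x_i} + ∑_{|I| < k} u_{I + e_i} ∂_{u_I}`. -/
def vecX (i : Fin n) (p : JetSpace n k) : JetSpace n k :=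
  (Pi.single i 1, fun I => if h : I.order < k then p.2 (I.succ h i) else 0)

/-- The coordinate vector field `∂_{u_I}`. -/
def vecU (I : MultiIndex n k) : JetSpace n k := (0, Pi.single I 1)

/-- The fibre at `p` of the horizontal subbundle, spanned by the `X_i` and by the `∂_{u_I}` with
`|I| = k`. -/
def horizontalSpace (p : JetSpace n k) : Submodule ℝ (JetSpace n k) :=
  Submodule.span ℝ
    (Set.range (fun i : Fin n => vecX i p) ∪ {v | ∃ I : MultiIndex n k, I.order = k ∧ v = vecU I})

/-- The coefficient of `∂_{u_I}` when the tangent vector `v` at `p` is written in the frame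
`(X_i, ∂_{u_I})`; the coefficient of `X_i` is `v.1 i`. -/
def coeffU (p v : JetSpace n k) (I : MultiIndex n k) : ℝ :=
  v.2 I - ∑ i, v.1 i * (vecX i p).2 I

theorem frame_expansion (p v : JetSpace n k) :
    v = ∑ i, v.1 i • vecX i p + ∑ I, coeffU p v I • vecU I := by
  refine Prod.ext ?_ ?_
  · ext j
    simp [vecX, vecU, Prod.fst_sum, Finset.sum_apply, Pi.single_apply]
  · ext J
    simp [coeffU, vecU, Prod.snd_sum, Finset.sum_apply, Pi.single_apply]

/-- The Riemannian metric `g₀` for which the frame `(X_i, ∂_{u_I})`, with `1 ≤ i ≤ n` and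
`|I| ≤ k`, is orthonormal. -/
def metricG (p v w : JetSpace n k) : ℝ :=
  ∑ i, v.1 i * w.1 i + ∑ I, coeffU p v I * coeffU p w I

theorem coeffU_vecX (p : JetSpace n k) (i : Fin n) (I : MultiIndex n k) :
    coeffU p (vecX i p) I = 0 := by
  have h : ∀ j, (vecX i p).1 j * (vecX j p).2 I = if j = i then (vecX i p).2 I else 0 := by
    intro j
    by_cases hj : j = i
    · subst hj; simp [vecX]
    · simp [vecX, hj]
  simp [coeffU, h]

theorem coeffU_vecU (p : JetSpace n k) (I J : MultiIndex n k) :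
    coeffU p (vecU I) J = if J = I then 1 else 0 := by
  simp [coeffU, vecU, Pi.single_apply]

theorem metricG_orthonormal (p : JetSpace n k) :
    (∀ i j : Fin n, metricG p (vecX i p) (vecX j p) = if i = j then 1 else 0) ∧
    (∀ (i : Fin n) (I : MultiIndex n k), metricG p (vecX i p) (vecU I) = 0) ∧
    (∀ I J : MultiIndex n k, metricG p (vecU I) (vecU J) = if I = J then 1 else 0) := by
  refine ⟨fun i j => ?_, fun i I => ?_, fun I J => ?_⟩
  · simp only [metricG, coeffU_vecX]
    simp [vecX, Pi.single_apply, eq_comm]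
  · simp only [metricG, coeffU_vecX]
    simp [vecU]
  · simp only [metricG, coeffU_vecU]
    simp [vecU, eq_comm]

/-- `γ`, restricted to `[0, 1]`, is a horizontal `C¹` curve from `p` to `q`. -/
structure IsHorizontalCurve (γ : ℝ → JetSpace n k) (p q : JetSpace n k) : Prop where
  contDiffOn : ContDiffOn ℝ 1 γ (Set.Icc 0 1)
  horizontal : ∀ t ∈ Set.Icc (0 : ℝ) 1,
    derivWithin γ (Set.Icc 0 1) t ∈ horizontalSpace (γ t)
  source : γ 0 = p
  target : γ 1 = q

/-- The length with respect to `g₀` of a curve parametrized by `[0, 1]`. -/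
def curveLength (γ : ℝ → JetSpace n k) : ℝ≥0∞ :=
  ∫⁻ t in Set.Icc (0 : ℝ) 1, ENNReal.ofReal
    (√(metricG (γ t) (derivWithin γ (Set.Icc 0 1) t) (derivWithin γ (Set.Icc 0 1) t)))

/-- The Carnot–Carathéodory distance `d_c`, the infimum of the lengths of the horizontal `C¹`
curves between two points (in `[0, ∞]`, so that no value is assigned by convention if there is
no such curve). -/
def ccDist (p q : JetSpace n k) : ℝ≥0∞ :=
  ⨅ (γ : ℝ → JetSpace n k) (_ : IsHorizontalCurve γ p q), curveLength γ

/-- The dilation `δ_L`, which multiplies `x` by `L` and `u_I` by `L ^ (k + 1 - |I|)`. -/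
def dilation (L : ℝ) (p : JetSpace n k) : JetSpace n k :=
  (fun i => L * p.1 i, fun I => L ^ (k + 1 - I.order) * p.2 I)

/-- `A` is a discrete subset for `d_c`: no point of the space is an accumulation point of `A`. -/
def IsDiscreteSubset (A : Set (JetSpace n k)) : Prop :=
  ∀ p, ∃ η : ℝ, 0 < η ∧ ∀ a ∈ A, ccDist p a < ENNReal.ofReal η → a = p

/-- `A` is `ε`-dense for `d_c`. -/
def IsEpsDense (ε : ℝ) (A : Set (JetSpace n k)) : Prop :=
  ∀ p, ∃ a ∈ A, ccDist p a ≤ ENNReal.ofReal ε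

/-- The space `l²(Γ)`. -/
abbrev L2 (Γ : Set (JetSpace n k)) : Type := lp (fun _ : Γ => ℝ) 2

open Classical in
/-- The vertex `e_c` of `l²(Γ)`, for `c ∈ Γ`. -/
def vertex {Γ : Set (JetSpace n k)} (c : Γ) : L2 Γ := lp.single 2 c (1 : ℝ)

/-- The complex `Σ(Γ, ε, N)`, as the set of its simplices `[e_{a_1}, …, e_{a_m}] ⊆ l²(Γ)`, where
`1 ≤ m ≤ N + 1` and `d_c(a_i, a_j) ≤ ε` for all `i`, `j`. -/
def ripsSimplices (Γ : Set (JetSpace n k)) (ε : ℝ) (N : ℕ) : Set (Set (L2 Γ)) :=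
  {S | ∃ s : Finset Γ, s.Nonempty ∧ s.card ≤ N + 1 ∧
    (∀ a ∈ s, ∀ b ∈ s, ccDist a.1 b.1 ≤ ENNReal.ofReal ε) ∧
    S = convexHull ℝ (vertex '' (s : Set Γ))}

/-- The restrictions of `F` to the simplices of the complex `Σ(Γ, ε, N)` are all `ϱ`-Lipschitz,
from the distance of `l²(Γ)` to `d_c`. -/
def LipschitzOnSimplices {Γ : Set (JetSpace n k)} (ϱ : ℝ≥0) (ε : ℝ) (N : ℕ)
    (F : L2 Γ → JetSpace n k) : Prop :=
  ∀ S ∈ ripsSimplices Γ ε N, ∀ v ∈ S, ∀ w ∈ S, ccDist (F v) (F w) ≤ ϱ * edist v w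

/-- For sets `B`, `Γ`, `Γ'` with `B ⊆ Γ` and `δ_r(B) ⊆ Γ'`: on every simplex
`[e_{b_1}, …, e_{b_m}]` with `m ≤ N + 1`, vertices in `B` and `d_c(b_i, b_j) ≤ ε / r`, the map
`G'` on `[e_{δ_r(b_1)}, …, e_{δ_r(b_m)}]` is `δ_r ∘ G` on `[e_{b_1}, …, e_{b_m}]`, the two
simplices being identified through their barycentric coordinates `t`. -/
def Intertwines {B Γ Γ' : Set (JetSpace n k)} (r : ℝ) (ε : ℝ) (N : ℕ)
    (hΓ : B ⊆ Γ) (hΓ' : dilation r '' B ⊆ Γ')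
    (G : L2 Γ → JetSpace n k) (G' : L2 Γ' → JetSpace n k) : Prop :=
  ∀ (m : ℕ) (_ : m ≤ N + 1) (b : Fin m → B)
    (_ : ∀ i j, ccDist (b i).1 (b j).1 ≤ ENNReal.ofReal (ε / r))
    (t : Fin m → ℝ) (_ : t ∈ stdSimplex ℝ (Fin m)),
    G' (∑ i, t i • vertex ⟨dilation r (b i).1, hΓ' (Set.mem_image_of_mem _ (b i).2)⟩) =
      dilation r (G (∑ i, t i • vertex ⟨(b i).1, hΓ (b i).2⟩))

end JetCarnot

end

open JetCarnot

/-!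
The map `F` is given by a formula in the barycentric coordinates `v` of a point of the complex, so
that its compatibility with faces is automatic and its compatibility with dilations can be read off.
A simplex with at most `n + 1` vertices is subdivided barycentrically. A vertex of the subdivision
is a set `S` of `j + 1` vertices with `0 ≤ j ≤ n`, and it is labelled by one of the jets of `S` (its
anchor). Since there are only `n` positive values of `j`, each of them can be given a coordinate
of `ℝⁿ` of its own: `place` pushes the coordinate belonging to `j` away from the affine
interpolation of the base points by an amount proportional to the barycentric coordinate of `S`, and
`blend` is a smooth function on `ℝⁿ` which switches to the Taylor polynomial of the anchor of `S`
where this coordinate is large. Then `F` is the `k`-jet of `blend` at `place` (`interp`). Levels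
with barycentric coordinate zero do not contribute, and one level always has a large one, which
makes all lower levels irrelevant; for this reason the formula does not depend on how ties between
barycentric coordinates are broken (`blend_congr`, `IsSorting.interp_eq`). The bound `n + 1` on the
number of vertices is what leaves enough coordinates for all the levels. No general position of the
base points is needed.

In a chamber of the subdivision `F` is the jet of one smooth function along an affine map. Jets of
functions are horizontal, and the speed of such a map is controlled by derivatives of order `k + 1`
(`ccDist_jet_le`). These do not see a common polynomial of degree `k`, and along a
horizontal curve the Taylor polynomial varies only through the components of the velocity with
`|I| = k` (`hasDerivWithinAt_taylorDeriv`), so that jets at bounded distance have Taylor polynomials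
at bounded distance (`abs_taylorDeriv_sub_le_of_ccDist_le`). This bounds the Lipschitz constant
uniformly in a chamber (`exists_lipschitz_of_isSorting`), and hence on every simplex, because
segments can be cut at the walls (`ccDist_le_of_chambers`) and `d_c` satisfies the triangle
inequality (`ccDist_triangle`).

The size of the blending region and the anchors on subsets of `δ_r(B)` are the dilates of those
on subsets of `B`. As all the formulas are homogeneous, this gives the intertwining relations
(`interp_dilation`), provided that `A` and `δ_r(A')`, and `A'` and `δ_r(A)`, are disjoint. To
this end `A` and `A'` are maximal separated subsets of the sets of jets whose first coordinate is
rational, respectively irrational.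
-/

noncomputable section

namespace JetCarnot

open Set
open scoped ContDiff

variable {n k : ℕ}

/-! ### Iterated partial derivatives -/

/-- The partial derivative `∂_i f`. -/
def pd (i : Fin n) (f : (Fin n → ℝ) → ℝ) : (Fin n → ℝ) → ℝ :=
  fun y => fderiv ℝ f y (Pi.single i 1)

/-- The iterated partial derivative along a list of directions, the head of the list being applied
first. -/
def pdList (l : List (Fin n)) (f : (Fin n → ℝ) → ℝ) : (Fin n → ℝ) → ℝ :=
  l.foldl (fun g i => pd i g) f

/-- A list of directions containing `i` exactly `I i` times. The order is arbitrary, which does not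
matter for smooth functions. -/
def dirList (I : Fin n → ℕ) : List (Fin n) :=
  (∑ i, I i • ({i} : Multiset (Fin n))).toList

/-- The partial derivative `∂_I f` of multi-index `I`. -/
def mpd (I : Fin n → ℕ) (f : (Fin n → ℝ) → ℝ) : (Fin n → ℝ) → ℝ := pdList (dirList I) f

@[simp] theorem pdList_nil (f : (Fin n → ℝ) → ℝ) : pdList [] f = f := rfl

@[simp] theorem pdList_cons (i : Fin n) (l : List (Fin n)) (f : (Fin n → ℝ) → ℝ) :
    pdList (i :: l) f = pdList l (pd i f) := rfl

theorem pdList_concat (l : List (Fin n)) (i : Fin n) (f : (Fin n → ℝ) → ℝ) :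
    pdList (l ++ [i]) f = pd i (pdList l f) := by
  simp [pdList]

theorem count_dirList (I : Fin n → ℕ) (i : Fin n) : (dirList I).count i = I i := by
  rw [dirList, ← Multiset.coe_count, Multiset.coe_toList, Multiset.count_sum']
  simp [Multiset.count_singleton]

theorem length_dirList (I : Fin n → ℕ) : (dirList I).length = ∑ i, I i := by
  simp [dirList]

theorem dirList_add_single (I : Fin n → ℕ) (i : Fin n) :
    (dirList (I + Pi.single i 1)).Perm (dirList I ++ [i]) := by
  rw [List.perm_iff_count]
  intro j
  by_cases h : j = i
  · subst h; simp [count_dirList]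
  · simp [count_dirList, h, Ne.symm h]

theorem contDiff_pd {f : (Fin n → ℝ) → ℝ} (hf : ContDiff ℝ ∞ f) (i : Fin n) :
    ContDiff ℝ ∞ (pd i f) :=
  (hf.fderiv_right (m := ∞) (by simp)).clm_apply contDiff_const

theorem contDiff_pdList {f : (Fin n → ℝ) → ℝ} (hf : ContDiff ℝ ∞ f) (l : List (Fin n)) :
    ContDiff ℝ ∞ (pdList l f) := by
  induction l generalizing f with
  | nil => exact hf
  | cons i l ih => exact ih (contDiff_pd hf i)

theorem pd_comm {f : (Fin n → ℝ) → ℝ} (hf : ContDiff ℝ ∞ f) (i j : Fin n) :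
    pd i (pd j f) = pd j (pd i f) := by
  funext y
  have hd : DifferentiableAt ℝ (fderiv ℝ f) y :=
    ((hf.fderiv_right (m := ∞) (by simp)).differentiable (by simp)) y
  have key : ∀ a b : Fin n,
      pd a (pd b f) y = fderiv ℝ (fderiv ℝ f) y (Pi.single a 1) (Pi.single b 1) := by
    intro a b
    have h : HasFDerivAt (pd b f) ((fderiv ℝ (fderiv ℝ f) y).flip (Pi.single b 1)) y := by
      have := hd.hasFDerivAt.clm_apply (hasFDerivAt_const (Pi.single b (1 : ℝ)) y)
      simpa [pd] using! this
    simp [pd, h.fderiv]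
  rw [key, key]
  exact (hf.contDiffAt.isSymmSndFDerivAt
    (by simpa using WithTop.coe_le_coe.2 (le_top (a := (2 : ℕ∞))))).eq _ _

theorem pdList_perm {l l' : List (Fin n)} (h : l.Perm l') {f : (Fin n → ℝ) → ℝ}
    (hf : ContDiff ℝ ∞ f) : pdList l f = pdList l' f := by
  induction h generalizing f with
  | nil => rfl
  | cons i _ ih => exact ih (contDiff_pd hf i)
  | swap i j l => simp [pd_comm hf i j]
  | trans _ _ ih₁ ih₂ => exact (ih₁ hf).trans (ih₂ hf)

theorem mpd_add_single {f : (Fin n → ℝ) → ℝ} (hf : ContDiff ℝ ∞ f) (I : Fin n → ℕ) (i : Fin n) :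
    mpd (I + Pi.single i 1) f = pd i (mpd I f) := by
  rw [mpd, pdList_perm (dirList_add_single I i) hf, pdList_concat]; rfl

theorem pd_congr {f g : (Fin n → ℝ) → ℝ} {y : Fin n → ℝ} (h : f =ᶠ[nhds y] g) (i : Fin n) :
    pd i f =ᶠ[nhds y] pd i g := by
  filter_upwards [h.fderiv (𝕜 := ℝ)] with z hz
  simp [pd, hz]

theorem pdList_congr {f g : (Fin n → ℝ) → ℝ} {y : Fin n → ℝ} (h : f =ᶠ[nhds y] g)
    (l : List (Fin n)) : pdList l f =ᶠ[nhds y] pdList l g := by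
  induction l generalizing f g with
  | nil => exact h
  | cons i l ih => exact ih (pd_congr h i)

theorem pd_add {f g : (Fin n → ℝ) → ℝ} (hf : ContDiff ℝ ∞ f) (hg : ContDiff ℝ ∞ g) (i : Fin n) :
    pd i (fun y => f y + g y) = fun y => pd i f y + pd i g y := by
  funext y
  simp [pd, fderiv_fun_add (hf.differentiable (by simp) y) (hg.differentiable (by simp) y)]

theorem pd_sub {f g : (Fin n → ℝ) → ℝ} (hf : ContDiff ℝ ∞ f) (hg : ContDiff ℝ ∞ g) (i : Fin n) :
    pd i (fun y => f y - g y) = fun y => pd i f y - pd i g y := by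
  funext y
  simp [pd, fderiv_fun_sub (hf.differentiable (by simp) y) (hg.differentiable (by simp) y)]

theorem pd_mul {f g : (Fin n → ℝ) → ℝ} (hf : ContDiff ℝ ∞ f) (hg : ContDiff ℝ ∞ g) (i : Fin n) :
    pd i (fun y => f y * g y) = fun y => pd i f y * g y + f y * pd i g y := by
  funext y
  simp [pd, fderiv_fun_mul (hf.differentiable (by simp) y) (hg.differentiable (by simp) y)]
  ring

theorem pdList_add {f g : (Fin n → ℝ) → ℝ} (hf : ContDiff ℝ ∞ f) (hg : ContDiff ℝ ∞ g)
    (l : List (Fin n)) :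
    pdList l (fun y => f y + g y) = fun y => pdList l f y + pdList l g y := by
  induction l generalizing f g with
  | nil => rfl
  | cons i l ih => simp [pd_add hf hg, ih (contDiff_pd hf i) (contDiff_pd hg i)]

theorem pdList_sub {f g : (Fin n → ℝ) → ℝ} (hf : ContDiff ℝ ∞ f) (hg : ContDiff ℝ ∞ g)
    (l : List (Fin n)) :
    pdList l (fun y => f y - g y) = fun y => pdList l f y - pdList l g y := by
  induction l generalizing f g with
  | nil => rfl
  | cons i l ih => simp [pd_sub hf hg, ih (contDiff_pd hf i) (contDiff_pd hg i)]

/-- Rescaling: `∂_l (a f(· / L)) = a L^{-|l|} (∂_l f)(· / L)`. -/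
theorem pdList_rescale {f : (Fin n → ℝ) → ℝ} (hf : ContDiff ℝ ∞ f) (a L : ℝ)
    (l : List (Fin n)) :
    pdList l (fun y => a * f (L⁻¹ • y)) = fun y => a * L⁻¹ ^ l.length * pdList l f (L⁻¹ • y) := by
  induction l generalizing f a with
  | nil => simp
  | cons i l ih =>
    have h : pd i (fun y => a * f (L⁻¹ • y)) = fun y => (a * L⁻¹) * pd i f (L⁻¹ • y) := by
      funext y
      have h1 : HasFDerivAt (fun y : Fin n → ℝ => L⁻¹ • y)
          (L⁻¹ • ContinuousLinearMap.id ℝ (Fin n → ℝ)) y := (hasFDerivAt_id y).const_smul L⁻¹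
      have h2 := ((hf.differentiable (by simp) (L⁻¹ • y)).hasFDerivAt.comp y h1).const_mul a
      have h3 : fderiv ℝ (fun y => a * f (L⁻¹ • y)) y = _ := h2.fderiv
      simp only [pd, h3]
      simp [mul_assoc]
    rw [pdList_cons, h, ih (contDiff_pd hf i)]
    funext y
    rw [List.length_cons, pdList_cons, pow_succ]; ring

/-- All the iterated partial derivatives of `f` up to order `m` are bounded by `C` on `U`. -/
def DerivBound (U : Set (Fin n → ℝ)) (m : ℕ) (C : ℝ) (f : (Fin n → ℝ) → ℝ) : Prop :=
  ∀ l : List (Fin n), l.length ≤ m → ∀ y ∈ U, |pdList l f y| ≤ C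

theorem DerivBound.add {U : Set (Fin n → ℝ)} {m : ℕ} {C C' : ℝ} {f g : (Fin n → ℝ) → ℝ}
    (hf : ContDiff ℝ ∞ f) (hg : ContDiff ℝ ∞ g) (h : DerivBound U m C f)
    (h' : DerivBound U m C' g) : DerivBound U m (C + C') (fun y => f y + g y) := by
  intro l hl y hy
  rw [pdList_add hf hg]
  exact (abs_add_le _ _).trans (add_le_add (h l hl y hy) (h' l hl y hy))

theorem DerivBound.sub {U : Set (Fin n → ℝ)} {m : ℕ} {C C' : ℝ} {f g : (Fin n → ℝ) → ℝ}
    (hf : ContDiff ℝ ∞ f) (hg : ContDiff ℝ ∞ g) (h : DerivBound U m C f)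
    (h' : DerivBound U m C' g) : DerivBound U m (C + C') (fun y => f y - g y) := by
  intro l hl y hy
  rw [pdList_sub hf hg]
  exact (abs_sub _ _).trans (add_le_add (h l hl y hy) (h' l hl y hy))

theorem DerivBound.pd {U : Set (Fin n → ℝ)} {m : ℕ} {C : ℝ} {f : (Fin n → ℝ) → ℝ}
    (h : DerivBound U (m + 1) C f) (i : Fin n) : DerivBound U m C (pd i f) :=
  fun l hl y hy => h (i :: l) (by simpa using hl) y hy

theorem DerivBound.mul {U : Set (Fin n → ℝ)} {m : ℕ} {C C' : ℝ} (hC : 0 ≤ C) (hC' : 0 ≤ C')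
    {f g : (Fin n → ℝ) → ℝ}
    (hf : ContDiff ℝ ∞ f) (hg : ContDiff ℝ ∞ g) (h : DerivBound U m C f)
    (h' : DerivBound U m C' g) : DerivBound U m (2 ^ m * (C * C')) (fun y => f y * g y) := by
  induction m generalizing f g with
  | zero =>
    intro l hl y hy
    obtain rfl : l = [] := by simpa using hl
    simp only [pdList_nil, abs_mul, pow_zero, one_mul]
    exact mul_le_mul (h [] le_rfl y hy) (h' [] le_rfl y hy) (abs_nonneg _) hC
  | succ m ih =>
    intro l hl y hy
    cases l with
    | nil =>
      simp only [pdList_nil, abs_mul]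
      have h1 := mul_le_mul (h [] (by simp) y hy) (h' [] (by simp) y hy) (abs_nonneg _) hC
      have h2 : (1 : ℝ) ≤ 2 ^ (m + 1) := one_le_pow₀ (by norm_num)
      simp only [pdList_nil] at h1
      nlinarith [mul_nonneg hC hC']
    | cons i l =>
      have hl' : l.length ≤ m := by simpa using hl
      have hm : ∀ {F : (Fin n → ℝ) → ℝ} {c : ℝ}, DerivBound U (m + 1) c F → DerivBound U m c F :=
        fun hF l hl y hy => hF l (by omega) y hy
      rw [pdList_cons, pd_mul hf hg,
        pdList_add ((contDiff_pd hf i).mul hg) (hf.mul (contDiff_pd hg i))]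
      have h1 := ih (contDiff_pd hf i) hg (h.pd i) (hm h') l hl' y hy
      have h2 := ih hf (contDiff_pd hg i) (hm h) (h'.pd i) l hl' y hy
      refine (abs_add_le _ _).trans ((add_le_add h1 h2).trans_eq ?_)
      ring

/-- The derivatives of a function of the single coordinate `y_i` at scale `R ≥ 1`. -/
theorem abs_pdList_coord_le {g : ℝ → ℝ} (hg : ContDiff ℝ ∞ g) (i : Fin n) (c R : ℝ) (hR : 1 ≤ R)
    (l : List (Fin n)) (y : Fin n → ℝ) :
    |pdList l (fun y => g ((y i - c) / R)) y| ≤ |iteratedDeriv l.length g ((y i - c) / R)| := by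
  suffices h : ∀ (l : List (Fin n)) (g : ℝ → ℝ), ContDiff ℝ ∞ g → ∀ a : ℝ,
      |pdList l (fun y => a * g ((y i - c) / R)) y| ≤
        |a| * |iteratedDeriv l.length g ((y i - c) / R)| by
    simpa using h l g hg 1
  intro l
  induction l with
  | nil => intro g _ a; simp [abs_mul]
  | cons j l ih =>
    intro g hg a
    have h1 : pd j (fun y => a * g ((y i - c) / R)) =
        fun y => (if j = i then a * R⁻¹ else 0) * deriv g ((y i - c) / R) := by
      funext y
      have h1 : HasFDerivAt (fun y : Fin n → ℝ => (y i - c) / R)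
          (R⁻¹ • ContinuousLinearMap.proj (R := ℝ) (φ := fun _ : Fin n => ℝ) i) y := by
        have := ((hasFDerivAt_apply (𝕜 := ℝ) i y).sub_const c).const_mul R⁻¹
        simpa [div_eq_inv_mul] using! this
      have h2 := ((hg.differentiable (by simp) ((y i - c) / R)).hasDerivAt.comp_hasFDerivAt y
        h1).const_mul a
      have h3 : fderiv ℝ (fun y => a * g ((y i - c) / R)) y = _ := h2.fderiv
      simp only [pd, h3]
      by_cases hj : j = i
      · subst hj; simp; ring
      · simp [hj, Ne.symm hj]
    have hg' : ContDiff ℝ ∞ (deriv g) := by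
      have := (contDiff_infty_iff_deriv (𝕜 := ℝ) (f := g)).1 hg
      exact this.2
    rw [pdList_cons, h1]
    refine (ih _ hg' _).trans ?_
    rw [List.length_cons, iteratedDeriv_succ']
    refine mul_le_mul_of_nonneg_right ?_ (abs_nonneg _)
    split_ifs
    · rw [abs_mul]
      refine mul_le_of_le_one_right (abs_nonneg _) ?_
      rw [abs_of_nonneg (by positivity)]
      exact inv_le_one_of_one_le₀ hR
    · simp

/-! ### The Carnot–Carathéodory distance -/

theorem coeffU_add (p v w : JetSpace n k) (I : MultiIndex n k) :
    coeffU p (v + w) I = coeffU p v I + coeffU p w I := by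
  simp only [coeffU, Prod.fst_add, Prod.snd_add, Pi.add_apply, add_mul, Finset.sum_add_distrib]
  ring

theorem coeffU_smul (p : JetSpace n k) (c : ℝ) (v : JetSpace n k) (I : MultiIndex n k) :
    coeffU p (c • v) I = c * coeffU p v I := by
  simp only [coeffU, Prod.smul_fst, Prod.smul_snd, Pi.smul_apply, smul_eq_mul, mul_sub,
    Finset.mul_sum, mul_assoc]

theorem mem_horizontalSpace_iff {p v : JetSpace n k} :
    v ∈ horizontalSpace p ↔ ∀ I : MultiIndex n k, I.order < k → coeffU p v I = 0 := by
  constructor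
  · intro hv I hI
    induction hv using Submodule.span_induction with
    | mem x hx =>
      rcases hx with ⟨i, rfl⟩ | ⟨J, hJ, rfl⟩
      · exact coeffU_vecX p i I
      · rw [coeffU_vecU, if_neg]
        rintro rfl
        omega
    | zero => simp [coeffU]
    | add x y _ _ hx hy => rw [coeffU_add, hx, hy, add_zero]
    | smul c x _ hx => rw [coeffU_smul, hx, mul_zero]
  · intro h
    rw [frame_expansion p v]
    refine Submodule.add_mem _ (Submodule.sum_mem _ fun i _ => ?_)
      (Submodule.sum_mem _ fun I _ => ?_)
    · exact Submodule.smul_mem _ _ (Submodule.subset_span (Or.inl ⟨i, rfl⟩))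
    · by_cases hI : I.order < k
      · rw [h I hI, zero_smul]; exact Submodule.zero_mem _
      · exact Submodule.smul_mem _ _
          (Submodule.subset_span (Or.inr ⟨I, le_antisymm I.2 (not_lt.1 hI), rfl⟩))

theorem metricG_smul (p : JetSpace n k) (c : ℝ) (v : JetSpace n k) :
    metricG p (c • v) (c • v) = c ^ 2 * metricG p v v := by
  simp only [metricG, coeffU_smul, Prod.smul_fst, Pi.smul_apply, smul_eq_mul, mul_add,
    Finset.mul_sum]
  congr 1 <;> exact Finset.sum_congr rfl fun _ _ => by ring

theorem continuous_vecX_snd (i : Fin n) (I : MultiIndex n k) :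
    Continuous fun p : JetSpace n k => (vecX i p).2 I := by
  unfold vecX
  by_cases h : I.order < k
  · simp only [h, dif_pos]; fun_prop
  · simp only [h, dif_neg, not_false_iff]; fun_prop

theorem continuous_metricG :
    Continuous fun x : JetSpace n k × JetSpace n k => metricG x.1 x.2 x.2 := by
  have h : ∀ (i : Fin n) (I : MultiIndex n k),
      Continuous fun x : JetSpace n k × JetSpace n k => (vecX i x.1).2 I :=
    fun i I => (continuous_vecX_snd i I).comp continuous_fst
  unfold metricG coeffU
  fun_prop

/-- The speed for `g₀` of the tangent vector `v` at `p`. -/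
def speed (p v : JetSpace n k) : ℝ := √(metricG p v v)

theorem speed_nonneg (p v : JetSpace n k) : 0 ≤ speed p v := Real.sqrt_nonneg _

theorem continuous_speed : Continuous fun x : JetSpace n k × JetSpace n k => speed x.1 x.2 :=
  continuous_metricG.sqrt

theorem speed_smul (p : JetSpace n k) (c : ℝ) (v : JetSpace n k) :
    speed p (c • v) = |c| * speed p v := by
  rw [speed, speed, metricG_smul, Real.sqrt_mul (sq_nonneg c), Real.sqrt_sq_eq_abs]

theorem abs_fst_le_speed (p v : JetSpace n k) (i : Fin n) : |v.1 i| ≤ speed p v := by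
  refine Real.le_sqrt_of_sq_le ?_
  rw [sq_abs, sq, metricG]
  have h1 := Finset.single_le_sum (f := fun i => v.1 i * v.1 i)
    (fun _ _ => mul_self_nonneg _) (Finset.mem_univ i)
  have h2 : 0 ≤ ∑ I, coeffU p v I * coeffU p v I :=
    Finset.sum_nonneg fun _ _ => mul_self_nonneg _
  linarith

theorem abs_coeffU_le_speed (p v : JetSpace n k) (I : MultiIndex n k) :
    |coeffU p v I| ≤ speed p v := by
  refine Real.le_sqrt_of_sq_le ?_
  rw [sq_abs, sq, metricG]
  have h1 := Finset.single_le_sum (f := fun I => coeffU p v I * coeffU p v I)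
    (fun _ _ => mul_self_nonneg _) (Finset.mem_univ I)
  have h2 : 0 ≤ ∑ i, v.1 i * v.1 i := Finset.sum_nonneg fun _ _ => mul_self_nonneg _
  linarith

theorem IsHorizontalCurve.continuousOn_derivWithin {γ : ℝ → JetSpace n k} {p q : JetSpace n k}
    (h : IsHorizontalCurve γ p q) : ContinuousOn (derivWithin γ (Icc 0 1)) (Icc 0 1) :=
  h.contDiffOn.continuousOn_derivWithin (uniqueDiffOn_Icc zero_lt_one) le_rfl

theorem IsHorizontalCurve.hasDerivWithinAt {γ : ℝ → JetSpace n k} {p q : JetSpace n k}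
    (h : IsHorizontalCurve γ p q) {t : ℝ} (ht : t ∈ Icc (0 : ℝ) 1) :
    HasDerivWithinAt γ (derivWithin γ (Icc 0 1) t) (Icc 0 1) t :=
  (h.contDiffOn.differentiableOn (by simp) t ht).hasDerivWithinAt

theorem IsHorizontalCurve.continuousOn_speed {γ : ℝ → JetSpace n k} {p q : JetSpace n k}
    (h : IsHorizontalCurve γ p q) :
    ContinuousOn (fun t => speed (γ t) (derivWithin γ (Icc 0 1) t)) (Icc 0 1) :=
  continuous_speed.comp_continuousOn (f := fun t => (γ t, derivWithin γ (Icc 0 1) t))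
    (h.contDiffOn.continuousOn.prodMk h.continuousOn_derivWithin)

/-- The length of a horizontal curve is the interval integral of its speed. -/
theorem IsHorizontalCurve.curveLength_eq {γ : ℝ → JetSpace n k} {p q : JetSpace n k}
    (h : IsHorizontalCurve γ p q) :
    curveLength γ =
      ENNReal.ofReal (∫ t in (0 : ℝ)..1, speed (γ t) (derivWithin γ (Icc 0 1) t)) := by
  rw [intervalIntegral.integral_of_le zero_le_one, ← MeasureTheory.integral_Icc_eq_integral_Ioc,
    MeasureTheory.ofReal_integral_eq_lintegral_ofReal]
  · rfl
  · exact h.continuousOn_speed.integrableOn_Icc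
  · exact Filter.Eventually.of_forall fun t => speed_nonneg _ _

theorem ccDist_le_curveLength {γ : ℝ → JetSpace n k} {p q : JetSpace n k}
    (h : IsHorizontalCurve γ p q) : ccDist p q ≤ curveLength γ :=
  iInf₂_le γ h

theorem exists_curve_of_ccDist_lt {p q : JetSpace n k} {c : ℝ≥0∞} (h : ccDist p q < c) :
    ∃ γ, IsHorizontalCurve γ p q ∧ curveLength γ < c := by
  simpa [ccDist, iInf_lt_iff] using h

/-- A globally `C¹` curve with horizontal tangents, restricted to `[0, 1]`. -/
theorem isHorizontalCurve_of_contDiff {γ : ℝ → JetSpace n k} (h : ContDiff ℝ 1 γ)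
    (hγ : ∀ t ∈ Icc (0 : ℝ) 1, deriv γ t ∈ horizontalSpace (γ t)) :
    IsHorizontalCurve γ (γ 0) (γ 1) := by
  refine ⟨h.contDiffOn, fun t ht => ?_, rfl, rfl⟩
  rw [((h.differentiable (by simp)) t).derivWithin (uniqueDiffOn_Icc zero_lt_one t ht)]
  exact hγ t ht

theorem ccDist_le_integral {γ : ℝ → JetSpace n k} (h : ContDiff ℝ 1 γ)
    (hγ : ∀ t ∈ Icc (0 : ℝ) 1, deriv γ t ∈ horizontalSpace (γ t)) :
    ccDist (γ 0) (γ 1) ≤ ENNReal.ofReal (∫ t in (0 : ℝ)..1, speed (γ t) (deriv γ t)) := by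
  have hc := isHorizontalCurve_of_contDiff h hγ
  refine (ccDist_le_curveLength hc).trans_eq ?_
  rw [hc.curveLength_eq]
  congr 1
  refine intervalIntegral.integral_congr fun t ht => ?_
  rw [uIcc_of_le zero_le_one] at ht
  rw [((h.differentiable (by simp)) t).derivWithin (uniqueDiffOn_Icc zero_lt_one t ht)]

/-- A horizontal curve can be reparametrized to a globally `C¹` curve of the same length which is
constant outside `[0, 1]`; concatenations of such curves are again `C¹`. -/
theorem IsHorizontalCurve.exists_reparam {γ : ℝ → JetSpace n k} {p q : JetSpace n k}
    (h : IsHorizontalCurve γ p q) :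
    ∃ η : ℝ → JetSpace n k, ContDiff ℝ 1 η ∧ (∀ t ≤ 0, η t = p) ∧ (∀ t, 1 ≤ t → η t = q) ∧
      (∀ t, deriv η t ∈ horizontalSpace (η t)) ∧
      curveLength γ = ENNReal.ofReal (∫ t in (0 : ℝ)..1, speed (η t) (deriv η t)) := by
  let ψ := Real.smoothTransition
  have hψ : ContDiff ℝ 1 ψ := Real.smoothTransition.contDiff
  have hmem : ∀ t, ψ t ∈ Icc (0 : ℝ) 1 :=
    fun t => ⟨Real.smoothTransition.nonneg t, Real.smoothTransition.le_one t⟩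
  have hd : ∀ t, HasDerivAt (γ ∘ ψ) (deriv ψ t • derivWithin γ (Icc 0 1) (ψ t)) t := fun t =>
    (h.hasDerivWithinAt (hmem t)).scomp_hasDerivAt t
      ((hψ.differentiable (by simp)) t).hasDerivAt hmem
  have hψ' : ∀ t, 0 ≤ deriv ψ t := fun t => Real.smoothTransition.monotone.deriv_nonneg
  refine ⟨γ ∘ ψ, ?_, fun t ht => ?_, fun t ht => ?_, fun t => ?_, ?_⟩
  · exact contDiffOn_univ.1 (h.contDiffOn.comp hψ.contDiffOn fun t _ => hmem t)
  · simp [ψ, Real.smoothTransition.zero_of_nonpos ht, h.source]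
  · simp [ψ, Real.smoothTransition.one_of_one_le ht, h.target]
  · rw [(hd t).deriv]
    exact Submodule.smul_mem _ _ (h.horizontal _ (hmem t))
  · rw [h.curveLength_eq]
    congr 1
    have := intervalIntegral.integral_comp_mul_deriv' (a := 0) (b := 1) (f := ψ) (f' := deriv ψ)
      (g := fun t => speed (γ t) (derivWithin γ (Icc 0 1) t))
      (fun t _ => ((hψ.differentiable (by simp)) t).hasDerivAt)
      (hψ.continuous_deriv le_rfl).continuousOn
      (h.continuousOn_speed.mono (by rintro _ ⟨t, -, rfl⟩; exact hmem t))
    simp only [ψ, Real.smoothTransition.zero, Real.smoothTransition.one] at this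
    rw [← this]
    refine intervalIntegral.integral_congr fun t _ => ?_
    rw [(hd t).deriv, speed_smul, abs_of_nonneg (hψ' t), mul_comm]
    rfl

theorem ccDist_triangle (p q r : JetSpace n k) : ccDist p r ≤ ccDist p q + ccDist q r := by
  suffices h : ∀ γ₁, IsHorizontalCurve γ₁ p q → ∀ γ₂, IsHorizontalCurve γ₂ q r →
      ccDist p r ≤ curveLength γ₁ + curveLength γ₂ by
    rw [ccDist, ccDist, ccDist]
    simp only [ENNReal.iInf_add, ENNReal.add_iInf]
    exact le_iInf fun γ₂ => le_iInf fun h₂ => le_iInf fun γ₁ => le_iInf fun h₁ =>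
      h γ₁ h₁ γ₂ h₂
  intro γ₁ h₁ γ₂ h₂
  obtain ⟨η₁, hη₁, hl₁, hr₁, hh₁, hlen₁⟩ := h₁.exists_reparam
  obtain ⟨η₂, hη₂, hl₂, hr₂, hh₂, hlen₂⟩ := h₂.exists_reparam
  let η : ℝ → JetSpace n k := fun t => η₁ (2 * t) + η₂ (2 * t - 1) - q
  have hη : ContDiff ℝ 1 η := by
    have a₁ : ContDiff ℝ 1 fun t : ℝ => η₁ (2 * t) := hη₁.comp (by fun_prop)
    have a₂ : ContDiff ℝ 1 fun t : ℝ => η₂ (2 * t - 1) := hη₂.comp (by fun_prop)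
    exact (a₁.add a₂).sub contDiff_const
  have hd : ∀ t, HasDerivAt η
      ((2 : ℝ) • deriv η₁ (2 * t) + (2 : ℝ) • deriv η₂ (2 * t - 1)) t := by
    intro t
    have e₁ : HasDerivAt (fun t : ℝ => 2 * t) 2 t := by
      simpa using (hasDerivAt_id t).const_mul (2 : ℝ)
    have b₁ := ((hη₁.differentiable (by simp)) (2 * t)).hasDerivAt.scomp t e₁
    have b₂ := ((hη₂.differentiable (by simp)) (2 * t - 1)).hasDerivAt.scomp t (e₁.sub_const 1)
    exact (b₁.add b₂).sub_const q
  -- The derivatives of the reparametrized curves vanish outside `(0, 1)`.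
  have z₁ : ∀ t, 1 ≤ t → deriv η₁ t = 0 := by
    intro t ht
    have c : HasDerivWithinAt η₁ (deriv η₁ t) (Ici t) t :=
      ((hη₁.differentiable (by simp)) t).hasDerivAt.hasDerivWithinAt
    have c' : HasDerivWithinAt η₁ 0 (Ici t) t :=
      (hasDerivWithinAt_const t (Ici t) q).congr (fun s hs => hr₁ s (ht.trans hs)) (hr₁ t ht)
    exact (uniqueDiffWithinAt_Ici t).eq_deriv _ c c'
  have z₂ : ∀ t ≤ 0, deriv η₂ t = 0 := by
    intro t ht
    have c : HasDerivWithinAt η₂ (deriv η₂ t) (Iic t) t :=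
      ((hη₂.differentiable (by simp)) t).hasDerivAt.hasDerivWithinAt
    have c' : HasDerivWithinAt η₂ 0 (Iic t) t :=
      (hasDerivWithinAt_const t (Iic t) q).congr (fun s hs => hl₂ s (le_trans hs ht)) (hl₂ t ht)
    exact (uniqueDiffWithinAt_Iic t).eq_deriv _ c c'
  have v₁ : ∀ t ≤ 1 / 2, η t = η₁ (2 * t) ∧ deriv η t = (2 : ℝ) • deriv η₁ (2 * t) := by
    intro t ht
    refine ⟨?_, ?_⟩
    · simp [η, hl₂ (2 * t - 1) (by linarith)]
    · rw [(hd t).deriv, z₂ (2 * t - 1) (by linarith)]; simp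
  have v₂ : ∀ t, 1 / 2 ≤ t → η t = η₂ (2 * t - 1) ∧
      deriv η t = (2 : ℝ) • deriv η₂ (2 * t - 1) := by
    intro t ht
    refine ⟨?_, ?_⟩
    · simp [η, hr₁ (2 * t) (by linarith)]
    · rw [(hd t).deriv, z₁ (2 * t) (by linarith)]; simp
  have hhor : ∀ t ∈ Icc (0 : ℝ) 1, deriv η t ∈ horizontalSpace (η t) := by
    intro t _
    rcases le_total t (1 / 2) with ht | ht
    · rw [(v₁ t ht).1, (v₁ t ht).2]
      exact Submodule.smul_mem _ _ (hh₁ _)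
    · rw [(v₂ t ht).1, (v₂ t ht).2]
      exact Submodule.smul_mem _ _ (hh₂ _)
  have e0 : η 0 = p := by
    rw [(v₁ 0 (by norm_num)).1]; exact hl₁ _ (by norm_num)
  have e1 : η 1 = r := by
    rw [(v₂ 1 (by norm_num)).1]; exact hr₂ _ (by norm_num)
  have hcont : Continuous fun t => speed (η t) (deriv η t) :=
    continuous_speed.comp (hη.continuous.prodMk (hη.continuous_deriv le_rfl))
  have key := ccDist_le_integral hη hhor
  rw [e0, e1] at key
  rw [hlen₁, hlen₂, ← ENNReal.ofReal_add]
  · refine key.trans_eq (congrArg _ ?_)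
    rw [← intervalIntegral.integral_add_adjacent_intervals (b := 1 / 2)
      (hcont.intervalIntegrable _ _) (hcont.intervalIntegrable _ _)]
    congr 1
    · have : ∫ t in (0 : ℝ)..1 / 2, speed (η t) (deriv η t) =
          ∫ t in (0 : ℝ)..1 / 2, 2 * speed (η₁ (2 * t)) (deriv η₁ (2 * t)) := by
        refine intervalIntegral.integral_congr fun t ht => ?_
        rw [uIcc_of_le (by norm_num)] at ht
        rw [(v₁ t ht.2).1, (v₁ t ht.2).2, speed_smul]
        norm_num
      rw [this, intervalIntegral.integral_const_mul,
        intervalIntegral.integral_comp_mul_left (fun s => speed (η₁ s) (deriv η₁ s)) two_ne_zero]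
      norm_num
      ring
    · have : ∫ t in (1 / 2 : ℝ)..1, speed (η t) (deriv η t) =
          ∫ t in (1 / 2 : ℝ)..1, 2 * speed (η₂ (2 * t - 1)) (deriv η₂ (2 * t - 1)) := by
        refine intervalIntegral.integral_congr fun t ht => ?_
        rw [uIcc_of_le (by norm_num)] at ht
        rw [(v₂ t ht.1).1, (v₂ t ht.1).2, speed_smul]
        norm_num
      rw [this, intervalIntegral.integral_const_mul,
        intervalIntegral.integral_comp_mul_sub (fun s => speed (η₂ s) (deriv η₂ s)) two_ne_zero]
      norm_num
      ring
  · exact intervalIntegral.integral_nonneg zero_le_one fun _ _ => speed_nonneg _ _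
  · exact intervalIntegral.integral_nonneg zero_le_one fun _ _ => speed_nonneg _ _

theorem ccDist_symm_le (p q : JetSpace n k) : ccDist q p ≤ ccDist p q := by
  refine le_iInf₂ fun γ h => ?_
  obtain ⟨η, hη, hl, hr, hh, hlen⟩ := h.exists_reparam
  have hd : ∀ t, HasDerivAt (fun t => η (1 - t)) ((-1 : ℝ) • deriv η (1 - t)) t := by
    intro t
    have e : HasDerivAt (fun t : ℝ => 1 - t) (-1) t := by
      simpa using (hasDerivAt_id t).const_sub 1
    exact ((hη.differentiable (by simp)) (1 - t)).hasDerivAt.scomp t e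
  have key := ccDist_le_integral (γ := fun t => η (1 - t)) (hη.comp (by fun_prop)) (by
    intro t _
    rw [(hd t).deriv]
    exact Submodule.smul_mem _ _ (hh _))
  simp only [sub_zero, sub_self, hl 0 le_rfl, hr 1 le_rfl] at key
  refine key.trans_eq ?_
  rw [hlen]
  congr 1
  have : ∫ t in (0 : ℝ)..1, speed (η (1 - t)) (deriv (fun t => η (1 - t)) t) =
      ∫ t in (0 : ℝ)..1, speed (η (1 - t)) (deriv η (1 - t)) := by
    refine intervalIntegral.integral_congr fun t _ => ?_
    rw [(hd t).deriv, speed_smul]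
    norm_num
  rw [this, intervalIntegral.integral_comp_sub_left (fun s => speed (η s) (deriv η s))]
  norm_num

theorem ccDist_comm (p q : JetSpace n k) : ccDist p q = ccDist q p :=
  le_antisymm (ccDist_symm_le q p) (ccDist_symm_le p q)

theorem ccDist_self (p : JetSpace n k) : ccDist p p = 0 := by
  have h := ccDist_le_integral (γ := fun _ => p) contDiff_const (by simp)
  have h0 : speed p (0 : JetSpace n k) = 0 := by
    have := speed_smul p 0 0
    simpa using this
  simpa [h0] using h

/-- A function that changes at most at `C` times the speed of a horizontal curve changes by at most
`C` times its length. -/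
theorem IsHorizontalCurve.abs_sub_le {γ : ℝ → JetSpace n k} {p q : JetSpace n k}
    (h : IsHorizontalCurve γ p q) {ℓ : ℝ} (hℓ : curveLength γ ≤ ENNReal.ofReal ℓ) (hℓ0 : 0 ≤ ℓ)
    {G G' : ℝ → ℝ} {C : ℝ} (hC : 0 ≤ C)
    (hG : ∀ t ∈ Icc (0 : ℝ) 1, HasDerivWithinAt G (G' t) (Icc 0 1) t)
    (hb : ∀ t ∈ Icc (0 : ℝ) 1, |G' t| ≤ C * speed (γ t) (derivWithin γ (Icc 0 1) t)) :
    ∀ t ∈ Icc (0 : ℝ) 1, |G t - G 0| ≤ C * ℓ := by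
  set σ : ℝ → ℝ := fun t => speed (γ t) (derivWithin γ (Icc 0 1) t) with hσ
  have hσc : ContinuousOn σ (Icc 0 1) := h.continuousOn_speed
  have hint : ∀ a ∈ Icc (0 : ℝ) 1, ∀ b ∈ Icc (0 : ℝ) 1,
      IntervalIntegrable σ MeasureTheory.volume a b := fun a ha b hb =>
    (hσc.mono (uIcc_subset_Icc ha hb)).intervalIntegrable
  have hI : ∫ t in (0 : ℝ)..1, σ t ≤ ℓ := by
    rw [h.curveLength_eq, ENNReal.ofReal_le_ofReal_iff hℓ0] at hℓ
    exact hℓ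
  have hB' : ∀ x ∈ Ico (0 : ℝ) 1,
      HasDerivWithinAt (fun x => C * ∫ t in (0 : ℝ)..x, σ t) (C * σ x) (Ici x) x := by
    intro x hx
    have hx' : x ∈ Icc (0 : ℝ) 1 := Ico_subset_Icc_self hx
    have hc : ContinuousWithinAt σ (Ioi x) x :=
      ((hσc x hx').mono_of_mem_nhdsWithin (Icc_mem_nhdsGE_of_mem hx)).mono Ioi_subset_Ici_self
    refine (intervalIntegral.integral_hasDerivWithinAt_right (hint 0 (by simp) x hx') ?_
      hc).const_mul C
    refine ⟨Icc 0 1, nhdsWithin_mono x Ioi_subset_Ici_self (Icc_mem_nhdsGE_of_mem hx), ?_⟩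
    exact hσc.aestronglyMeasurable measurableSet_Icc
  have hBc : ContinuousOn (fun x => C * ∫ t in (0 : ℝ)..x, σ t) (Icc 0 1) := by
    refine continuousOn_const.mul ?_
    have := intervalIntegral.continuousOn_primitive_interval'
      (hint 0 (by simp) 1 (by simp)) (left_mem_uIcc)
    rwa [uIcc_of_le zero_le_one] at this
  have main := image_norm_le_of_norm_deriv_right_le_deriv_boundary' (a := 0) (b := 1)
    (f := fun t => G t - G 0) (f' := G')
    (B := fun x => C * ∫ t in (0 : ℝ)..x, σ t) (B' := fun x => C * σ x)
    (fun t ht => ((hG t ht).sub_const _).continuousWithinAt)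
    (fun t ht => ((hG t (Ico_subset_Icc_self ht)).sub_const _).mono_of_mem_nhdsWithin
      (Icc_mem_nhdsGE_of_mem ht))
    (by simp) hBc hB' (fun t ht => hb t (Ico_subset_Icc_self ht))
  intro t ht
  refine (main ht).trans (mul_le_mul_of_nonneg_left (le_trans ?_ hI) hC)
  rw [← intervalIntegral.integral_add_adjacent_intervals (hint 0 (by simp) t ht)
    (hint t ht 1 (by simp))]
  have : 0 ≤ ∫ s in t..1, σ s :=
    intervalIntegral.integral_nonneg ht.2 fun _ _ => speed_nonneg _ _
  linarith

/-! ### Jets of functions are horizontal -/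

/-- The `k`-jet of `f` at `y`. -/
def jet (k : ℕ) (f : (Fin n → ℝ) → ℝ) (y : Fin n → ℝ) : JetSpace n k :=
  (y, fun I => mpd I.1 f y)

theorem jet_congr {f g : (Fin n → ℝ) → ℝ} {y : Fin n → ℝ} (h : f =ᶠ[nhds y] g) :
    jet k f y = jet k g y :=
  Prod.ext rfl (funext fun I => (pdList_congr h (dirList I.1)).eq_of_nhds)

theorem hasDerivAt_comp_line {g : (Fin n → ℝ) → ℝ} (hg : ContDiff ℝ ∞ g) (y d : Fin n → ℝ)
    (u : ℝ) : HasDerivAt (fun u : ℝ => g (y + u • d)) (∑ i, d i * pd i g (y + u • d)) u := by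
  have h1 : HasDerivAt (fun u : ℝ => y + u • d) d u := by
    simpa using ((hasDerivAt_id u).smul_const d).const_add y
  have h2 := ((hg.differentiable (by simp)) (y + u • d)).hasFDerivAt.comp_hasDerivAt u h1
  have h3 : ∀ L : (Fin n → ℝ) →L[ℝ] ℝ, ∑ i, d i * L (Pi.single i 1) = L d := by
    intro L
    conv_rhs => rw [← Finset.univ_sum_single d, map_sum]
    refine Finset.sum_congr rfl fun i _ => ?_
    rw [← smul_eq_mul, ← map_smul, ← Pi.single_smul]
    simp
  simp only [pd, h3]
  exact h2

theorem coeffU_line {f : (Fin n → ℝ) → ℝ} (hf : ContDiff ℝ ∞ f) (z d : Fin n → ℝ)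
    (I : MultiIndex n k) :
    coeffU (jet k f z) (d, fun I => ∑ i, d i * pd i (mpd I.1 f) z) I =
      if I.order < k then 0 else ∑ i, d i * pd i (mpd I.1 f) z := by
  unfold coeffU
  by_cases h : I.order < k
  · simp [h, vecX, jet, MultiIndex.succ, mpd_add_single hf]
  · simp [h, vecX]

/-- The map `jet k f` sends a segment with increment `d` to a horizontal curve, whose length
is controlled by `d` and by the derivatives of `f` of order `k + 1`. -/
theorem ccDist_jet_le {f : (Fin n → ℝ) → ℝ} (hf : ContDiff ℝ ∞ f) (y d : Fin n → ℝ) {C δ : ℝ}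
    (hδ : 0 ≤ δ) (hd : ∀ i, |d i| ≤ δ)
    (hb : ∀ u ∈ Icc (0 : ℝ) 1, ∀ l : List (Fin n), l.length = k + 1 →
      |pdList l f (y + u • d)| ≤ C) :
    ccDist (jet k f y) (jet k f (y + d)) ≤
      ENNReal.ofReal (δ * √(n + Fintype.card (MultiIndex n k) * (n * C) ^ 2)) := by
  have hγ : ContDiff ℝ 1 fun u : ℝ => jet k f (y + u • d) := by
    refine ContDiff.prodMk (by fun_prop) (contDiff_pi.2 fun I => ?_)
    exact ((contDiff_pdList hf _).of_le (by simp)).comp (by fun_prop)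
  have hder : ∀ u : ℝ, HasDerivAt (fun u : ℝ => jet k f (y + u • d))
      (d, fun I : MultiIndex n k => ∑ i, d i * pd i (mpd I.1 f) (y + u • d)) u := by
    intro u
    refine HasDerivAt.prodMk ?_ (hasDerivAt_pi.2 fun I => ?_)
    · simpa using ((hasDerivAt_id u).smul_const d).const_add y
    · exact hasDerivAt_comp_line (contDiff_pdList hf _) y d u
  have key := ccDist_le_integral hγ (fun u _ => by
    rw [(hder u).deriv, mem_horizontalSpace_iff]
    intro I hI
    rw [coeffU_line hf, if_pos hI])
  simp only [zero_smul, add_zero, one_smul] at key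
  refine key.trans (ENNReal.ofReal_le_ofReal ?_)
  have hcont : Continuous fun u : ℝ => speed (jet k f (y + u • d))
      (deriv (fun u : ℝ => jet k f (y + u • d)) u) :=
    continuous_speed.comp (hγ.continuous.prodMk (hγ.continuous_deriv le_rfl))
  have hmono := intervalIntegral.integral_mono_on (a := 0) (b := 1)
    (μ := MeasureTheory.volume) zero_le_one
    (hcont.intervalIntegrable _ _)
    (continuous_const (y := δ * √(n + Fintype.card (MultiIndex n k) * (n * C) ^ 2))
      |>.intervalIntegrable _ _) (fun u hu => ?_)
  · simpa using hmono
  rw [(hder u).deriv, speed]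
  rw [show δ * √(n + Fintype.card (MultiIndex n k) * (n * C) ^ 2) =
    √(δ ^ 2 * (n + Fintype.card (MultiIndex n k) * (n * C) ^ 2)) by
      rw [Real.sqrt_mul (sq_nonneg δ), Real.sqrt_sq hδ]]
  refine Real.sqrt_le_sqrt ?_
  have h1 : ∀ i, d i * d i ≤ δ ^ 2 := fun i => by
    rw [← sq, ← sq_abs]; exact pow_le_pow_left₀ (abs_nonneg _) (hd i) 2
  have h2 : ∀ I : MultiIndex n k,
      coeffU (jet k f (y + u • d)) (d, fun I => ∑ i, d i * pd i (mpd I.1 f) (y + u • d)) I *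
      coeffU (jet k f (y + u • d)) (d, fun I => ∑ i, d i * pd i (mpd I.1 f) (y + u • d)) I
        ≤ δ ^ 2 * (n * C) ^ 2 := by
    intro I
    rw [coeffU_line hf]
    split_ifs with hI
    · simp only [mul_zero]; positivity
    · have hlen : (dirList I.1).length = k :=
        (length_dirList I.1).trans (le_antisymm I.2 (not_lt.1 hI))
      have h3 : |∑ i, d i * pd i (mpd I.1 f) (y + u • d)| ≤ δ * (n * C) := by
        refine (Finset.abs_sum_le_sum_abs _ _).trans ?_
        refine (Finset.sum_le_card_nsmul _ _ (δ * C) fun i _ => ?_).trans_eq ?_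
        · rw [abs_mul]
          refine mul_le_mul (hd i) ?_ (abs_nonneg _) hδ
          have := hb u hu (dirList I.1 ++ [i]) (by simp [hlen])
          rwa [pdList_concat] at this
        · simp; ring
      rw [← sq, ← sq_abs, ← mul_pow]
      exact pow_le_pow_left₀ (abs_nonneg _) h3 2
  refine (add_le_add (Finset.sum_le_card_nsmul _ _ _ fun i _ => h1 i)
    (Finset.sum_le_card_nsmul _ _ _ fun I _ => h2 I)).trans_eq ?_
  simp
  ring

/-! ### Taylor polynomials -/

/-- The `b`-th derivative of `z ^ a / a!`. -/
def divPow (a b : ℕ) (z : ℝ) : ℝ := if b ≤ a then z ^ (a - b) / (a - b).factorial else 0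

theorem hasDerivAt_divPow (a b : ℕ) (z : ℝ) : HasDerivAt (divPow a b) (divPow a (b + 1) z) z := by
  unfold divPow
  rcases lt_trichotomy b a with h | rfl | h
  · obtain ⟨c, rfl⟩ := Nat.exists_eq_add_of_lt h
    have e1 : b + c + 1 - b = c + 1 := by omega
    have e2 : b + c + 1 - (b + 1) = c := by omega
    simp only [e1, e2, show b ≤ b + c + 1 by omega, show b + 1 ≤ b + c + 1 by omega, if_true]
    refine ((hasDerivAt_pow (c + 1) z).div_const ((c + 1).factorial : ℝ)).congr_deriv ?_
    rw [Nat.factorial_succ, Nat.add_sub_cancel]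
    push_cast
    field_simp
  · simpa using hasDerivAt_const z (1 : ℝ)
  · simpa [not_le.2 h, not_le.2 (h.trans (Nat.lt_succ_self b))] using
      hasDerivAt_const z (0 : ℝ)

theorem contDiff_divPow (a b : ℕ) : ContDiff ℝ ∞ (divPow a b) := by
  unfold divPow
  split_ifs <;> fun_prop

theorem divPow_zero (a b : ℕ) : divPow a b 0 = if a = b then 1 else 0 := by
  unfold divPow
  rcases lt_trichotomy b a with h | rfl | h
  · simp [h.le, h.ne', Nat.sub_ne_zero_of_lt h]
  · simp
  · simp [not_le.2 h, h.ne]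

theorem abs_divPow_le {a b : ℕ} (ha : a ≤ k) {z B : ℝ} (hB : 1 ≤ B) (hz : |z| ≤ B) :
    |divPow a b z| ≤ B ^ k := by
  unfold divPow
  split_ifs
  · rw [abs_div, abs_pow, Nat.abs_cast]
    have h1 : (1 : ℝ) ≤ (a - b).factorial := by exact_mod_cast Nat.factorial_pos _
    refine (div_le_self (by positivity) h1).trans ?_
    exact (pow_le_pow_left₀ (abs_nonneg _) hz _).trans (pow_le_pow_right₀ hB (by omega))
  · rw [abs_zero]; positivity

/-- The derivative `∂_J` of the monomial `z ^ I / I!`. -/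
def divMono (I J : Fin n → ℕ) (z : Fin n → ℝ) : ℝ := ∏ i, divPow (I i) (J i) (z i)

theorem hasFDerivAt_divMono (I J : Fin n → ℕ) (z : Fin n → ℝ) :
    HasFDerivAt (divMono I J) (∑ i, divMono I (J + Pi.single i 1) z •
      ContinuousLinearMap.proj (R := ℝ) (φ := fun _ : Fin n => ℝ) i) z := by
  have h := HasFDerivAt.finsetProd (u := Finset.univ) (x := z)
    (g := fun i (z : Fin n → ℝ) => divPow (I i) (J i) (z i))
    (g' := fun i => divPow (I i) (J i + 1) (z i) •
      ContinuousLinearMap.proj (R := ℝ) (φ := fun _ : Fin n => ℝ) i)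
    (fun i _ => HasDerivAt.comp_hasFDerivAt (f := fun z : Fin n → ℝ => z i) z
      (hasDerivAt_divPow (I i) (J i) (z i)) (hasFDerivAt_apply i z))
  refine h.congr_fderiv (Finset.sum_congr rfl fun i _ => ?_)
  rw [smul_smul]
  congr 1
  rw [divMono, ← Finset.prod_erase_mul _ _ (Finset.mem_univ i)]
  congr 1
  · refine Finset.prod_congr rfl fun j hj => ?_
    simp [Finset.ne_of_mem_erase hj]
  · simp

theorem contDiff_divMono (I J : Fin n → ℕ) : ContDiff ℝ ∞ (divMono I J) := by
  unfold divMono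
  exact contDiff_prod fun i _ => (contDiff_divPow _ _).comp (contDiff_apply ℝ ℝ i)

theorem divMono_zero (I J : Fin n → ℕ) : divMono I J 0 = if I = J then 1 else 0 := by
  unfold divMono
  simp only [Pi.zero_apply, divPow_zero]
  rw [Finset.prod_ite_zero]
  simp [funext_iff]

theorem divMono_eq_zero {I J : Fin n → ℕ} {i : Fin n} (h : I i < J i) (z : Fin n → ℝ) :
    divMono I J z = 0 :=
  Finset.prod_eq_zero (Finset.mem_univ i) (by simp [divPow, not_le.2 h])

theorem divMono_add (I J K : Fin n → ℕ) (z : Fin n → ℝ) :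
    divMono (I + K) (J + K) z = divMono I J z := by
  simp [divMono, divPow, Nat.add_sub_add_right]

theorem abs_divMono_le (I : MultiIndex n k) (J : Fin n → ℕ) {z : Fin n → ℝ} {B : ℝ} (hB : 1 ≤ B)
    (hz : ∀ i, |z i| ≤ B) : |divMono I.1 J z| ≤ (B ^ k) ^ n := by
  rw [divMono, Finset.abs_prod]
  refine (Finset.prod_le_prod (fun _ _ => abs_nonneg _) fun i _ =>
    abs_divPow_le (k := k) ?_ hB (hz i)).trans_eq (by simp)
  exact (Finset.single_le_sum (f := I.1) (fun _ _ => Nat.zero_le _) (Finset.mem_univ i)).trans I.2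

/-- The derivative `∂_J` of the Taylor polynomial of the jet `p`, as a function of `y`. -/
def taylorDeriv (p : JetSpace n k) (J : Fin n → ℕ) (y : Fin n → ℝ) : ℝ :=
  ∑ I : MultiIndex n k, p.2 I * divMono I.1 J (y - p.1)

/-- The polynomial of degree at most `k` with the `k`-jet `p` at the point `p.1`. -/
def taylor (p : JetSpace n k) : (Fin n → ℝ) → ℝ := taylorDeriv p 0

theorem contDiff_taylorDeriv (p : JetSpace n k) (J : Fin n → ℕ) :
    ContDiff ℝ ∞ (taylorDeriv p J) := by
  unfold taylorDeriv
  exact ContDiff.sum fun I _ => contDiff_const.mul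
    ((contDiff_divMono _ _).comp (contDiff_id.sub contDiff_const))

theorem contDiff_taylor (p : JetSpace n k) : ContDiff ℝ ∞ (taylor p) := contDiff_taylorDeriv p 0

theorem pd_taylorDeriv (p : JetSpace n k) (J : Fin n → ℕ) (i : Fin n) :
    pd i (taylorDeriv p J) = taylorDeriv p (J + Pi.single i 1) := by
  funext y
  have h : HasFDerivAt (taylorDeriv p J) (∑ I : MultiIndex n k, p.2 I •
      ∑ i, divMono I.1 (J + Pi.single i 1) (y - p.1) •
        ContinuousLinearMap.proj (R := ℝ) (φ := fun _ : Fin n => ℝ) i) y := by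
    refine HasFDerivAt.fun_sum fun I _ => HasFDerivAt.const_mul ?_ _
    exact (hasFDerivAt_divMono I.1 J (y - p.1)).comp y ((hasFDerivAt_id y).sub_const p.1)
  rw [pd, h.fderiv]
  simp [taylorDeriv, Pi.single_apply]

theorem pdList_taylorDeriv (p : JetSpace n k) (l : List (Fin n)) (J : Fin n → ℕ) :
    pdList l (taylorDeriv p J) = taylorDeriv p (J + fun i => l.count i) := by
  induction l generalizing J with
  | nil => congr 1
  | cons i l ih =>
    rw [pdList_cons, pd_taylorDeriv, ih, add_assoc]
    congr 2
    funext j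
    by_cases h : j = i
    · subst h; simp [add_comm]
    · simp [h, List.count_cons_of_ne (Ne.symm h)]

theorem pdList_taylor (p : JetSpace n k) (l : List (Fin n)) :
    pdList l (taylor p) = taylorDeriv p fun i => l.count i := by
  rw [taylor, pdList_taylorDeriv, zero_add]

theorem taylorDeriv_self (p : JetSpace n k) (J : MultiIndex n k) :
    taylorDeriv p J.1 p.1 = p.2 J := by
  simp [taylorDeriv, divMono_zero, ← Subtype.ext_iff]

theorem jet_taylor_self (p : JetSpace n k) : jet k (taylor p) p.1 = p := by
  refine Prod.ext rfl (funext fun J => ?_)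
  simp only [jet, mpd, pdList_taylor, count_dirList]
  exact taylorDeriv_self p J

theorem taylorDeriv_eq_zero (p : JetSpace n k) {J : Fin n → ℕ} (hJ : k < ∑ i, J i)
    (y : Fin n → ℝ) : taylorDeriv p J y = 0 := by
  refine Finset.sum_eq_zero fun I _ => ?_
  obtain ⟨i, -, hi⟩ := Finset.exists_lt_of_sum_lt (I.2.trans_lt hJ)
  rw [divMono_eq_zero hi, mul_zero]

theorem sum_count_eq_length (l : List (Fin n)) : ∑ i, l.count i = l.length := by
  induction l with
  | nil => simp
  | cons j l ih => simp [List.count_cons, Finset.sum_add_distrib, ih]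

theorem pdList_taylor_eq_zero (p : JetSpace n k) {l : List (Fin n)} (hl : k < l.length)
    (y : Fin n → ℝ) : pdList l (taylor p) y = 0 := by
  rw [pdList_taylor]
  exact taylorDeriv_eq_zero p (by rwa [sum_count_eq_length]) y

/-! ### Taylor polynomials along horizontal curves -/

theorem sum_vecX_divMono (p : JetSpace n k) (i : Fin n) (J : Fin n → ℕ) (z : Fin n → ℝ) :
    ∑ I, (vecX i p).2 I * divMono I.1 J z =
      ∑ I : MultiIndex n k, p.2 I * divMono I.1 (J + Pi.single i 1) z := by
  have hlt : ∀ I : MultiIndex n k, (vecX i p).2 I * divMono I.1 J z ≠ 0 → I.order < k := by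
    intro I hI
    by_contra h
    simp [vecX, h] at hI
  refine Finset.sum_bij_ne_zero (fun I _ hI => I.succ (hlt I hI) i) (fun _ _ _ => Finset.mem_univ _)
    ?_ ?_ ?_
  · intro I₁ _ h₁ I₂ _ h₂ h
    have := congrArg Subtype.val h
    simp only [MultiIndex.succ] at this
    exact Subtype.ext (add_right_cancel this)
  · intro I _ hI
    have h1 : 1 ≤ I.1 i := by
      by_contra h
      exact hI (by rw [divMono_eq_zero (i := i) (by simp; omega), mul_zero])
    have h2 : (I.1 - Pi.single i 1) + Pi.single i 1 = I.1 := by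
      refine tsub_add_cancel_of_le fun j => ?_
      by_cases hj : j = i
      · subst hj; simpa using h1
      · simp [hj]
    have h3 : ∑ j, (I.1 - Pi.single i 1 : Fin n → ℕ) j + 1 = ∑ j, I.1 j := by
      conv_rhs => rw [← h2]
      simp [Finset.sum_add_distrib]
    have hI2 := I.2
    let I' : MultiIndex n k := ⟨I.1 - Pi.single i 1, by omega⟩
    have hI' : I'.order < k := by
      change ∑ j, (I.1 - Pi.single i 1 : Fin n → ℕ) j < k
      omega
    have h4 : I'.succ hI' i = I := Subtype.ext h2
    have h5 : (vecX i p).2 I' * divMono I'.1 J z =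
        p.2 I * divMono I.1 (J + Pi.single i 1) z := by
      simp only [vecX, hI', dif_pos, h4]
      rw [← divMono_add I'.1 J (Pi.single i 1)]
      exact congrArg (fun L => p.2 I * divMono L (J + Pi.single i 1) z) h2
    exact ⟨I', Finset.mem_univ _, by rwa [h5], h4⟩
  · intro I _ hI
    simp only [vecX, hlt I hI, dif_pos, MultiIndex.succ, divMono_add]

/-- Along a horizontal curve the value at a fixed point of a derivative of the Taylor polynomial
changes only through the components of the velocity along the `∂_{u_I}` with `|I| = k`. -/
theorem hasDerivWithinAt_taylorDeriv {γ : ℝ → JetSpace n k} {v : JetSpace n k} {s : Set ℝ} {t : ℝ}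
    (h : HasDerivWithinAt γ v s t) (J : Fin n → ℕ) (y : Fin n → ℝ) :
    HasDerivWithinAt (fun t => taylorDeriv (γ t) J y)
      (∑ I, coeffU (γ t) v I * divMono I.1 J (y - (γ t).1)) s t := by
  have h1 : HasDerivWithinAt (fun t => (γ t).1) v.1 s t := h.fst
  have h2 : ∀ I, HasDerivWithinAt (fun t => (γ t).2 I) (v.2 I) s t :=
    hasDerivWithinAt_pi.1 h.snd
  have h3 : HasDerivWithinAt (fun t => taylorDeriv (γ t) J y)
      (∑ I : MultiIndex n k, (v.2 I * divMono I.1 J (y - (γ t).1) + (γ t).2 I *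
        (∑ i, divMono I.1 (J + Pi.single i 1) (y - (γ t).1) •
          ContinuousLinearMap.proj (R := ℝ) (φ := fun _ : Fin n => ℝ) i) (-v.1))) s t := by
    refine HasDerivWithinAt.fun_sum fun I _ => (h2 I).mul ?_
    exact HasFDerivAt.comp_hasDerivWithinAt (l := divMono I.1 J) (f := fun t => y - (γ t).1) t
      (hasFDerivAt_divMono I.1 J (y - (γ t).1)) (h1.const_sub y)
  convert h3 using 1
  simp only [coeffU, sub_mul, Finset.sum_mul, Finset.sum_sub_distrib, Finset.sum_add_distrib]
  rw [sub_eq_add_neg]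
  congr 1
  rw [Finset.sum_comm]
  simp only [mul_assoc, ← Finset.mul_sum, sum_vecX_divMono]
  simp only [sum_apply, smul_apply,
    ContinuousLinearMap.proj_apply, Pi.neg_apply, smul_eq_mul, Finset.mul_sum]
  rw [Finset.sum_comm, ← Finset.sum_neg_distrib]
  refine Finset.sum_congr rfl fun I _ => ?_
  rw [← Finset.sum_neg_distrib]
  exact Finset.sum_congr rfl fun i _ => by ring

theorem IsHorizontalCurve.abs_fst_sub_le {γ : ℝ → JetSpace n k} {p q : JetSpace n k}
    (h : IsHorizontalCurve γ p q) {ℓ : ℝ} (hℓ0 : 0 ≤ ℓ) (hℓ : curveLength γ ≤ ENNReal.ofReal ℓ)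
    (i : Fin n) : ∀ t ∈ Icc (0 : ℝ) 1, |(γ t).1 i - p.1 i| ≤ ℓ := by
  have := h.abs_sub_le hℓ hℓ0 zero_le_one (G := fun t => (γ t).1 i)
    (fun t ht => hasDerivWithinAt_pi.1 (h.hasDerivWithinAt ht).fst i)
    (fun t _ => by rw [one_mul]; exact abs_fst_le_speed _ _ i)
  simpa [h.source] using this

theorem IsHorizontalCurve.abs_taylorDeriv_sub_le {γ : ℝ → JetSpace n k} {p q : JetSpace n k}
    (h : IsHorizontalCurve γ p q) {ℓ B : ℝ} (hℓ0 : 0 ≤ ℓ)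
    (hℓ : curveLength γ ≤ ENNReal.ofReal ℓ) (hB : 1 ≤ B) {y : Fin n → ℝ}
    (hy : ∀ i, |y i - p.1 i| + ℓ ≤ B) (J : Fin n → ℕ) :
    |taylorDeriv q J y - taylorDeriv p J y| ≤
      Fintype.card (MultiIndex n k) * (B ^ k) ^ n * ℓ := by
  have := h.abs_sub_le hℓ hℓ0 (C := Fintype.card (MultiIndex n k) * (B ^ k) ^ n) (by positivity)
    (G := fun t => taylorDeriv (γ t) J y)
    (fun t ht => hasDerivWithinAt_taylorDeriv (h.hasDerivWithinAt ht) J y) (fun t ht => ?_)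
    1 (by simp)
  · simpa [h.source, h.target] using this
  · refine (Finset.abs_sum_le_sum_abs _ _).trans ((Finset.sum_le_card_nsmul _ _
      ((B ^ k) ^ n * speed (γ t) (derivWithin γ (Icc 0 1) t)) fun I _ => ?_).trans_eq ?_)
    · rw [abs_mul, mul_comm]
      refine mul_le_mul (abs_divMono_le I J hB fun i => ?_) (abs_coeffU_le_speed _ _ _)
        (abs_nonneg _) (by positivity)
      have h1 := h.abs_fst_sub_le hℓ0 hℓ i t ht
      have h2 := hy i
      have h3 := _root_.abs_sub_le (y i) (p.1 i) ((γ t).1 i)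
      rw [abs_sub_comm (p.1 i)] at h3
      simp only [Pi.sub_apply]
      linarith
    · simp [mul_assoc]

theorem abs_fst_sub_le_of_ccDist_le {p q : JetSpace n k} {ε : ℝ} (hε : 0 < ε)
    (h : ccDist p q ≤ ENNReal.ofReal ε) (i : Fin n) : |q.1 i - p.1 i| ≤ ε + 1 := by
  obtain ⟨γ, hγ, hl⟩ := exists_curve_of_ccDist_lt
    (h.trans_lt ((ENNReal.ofReal_lt_ofReal_iff (by linarith)).2 (lt_add_one ε)))
  simpa [hγ.target] using hγ.abs_fst_sub_le (by linarith) hl.le i 1 (by simp)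

/-- The Taylor polynomials of jets at bounded distance differ by a polynomial which is bounded near
the base points, with all its derivatives. -/
theorem abs_taylorDeriv_sub_le_of_ccDist_le {p q : JetSpace n k} {ε B : ℝ} (hε : 0 < ε)
    (hB : 0 ≤ B) (h : ccDist p q ≤ ENNReal.ofReal ε) {y : Fin n → ℝ}
    (hy : ∀ i, |y i - p.1 i| ≤ B) (J : Fin n → ℕ) :
    |taylorDeriv q J y - taylorDeriv p J y| ≤
      Fintype.card (MultiIndex n k) * ((B + (ε + 1)) ^ k) ^ n * (ε + 1) := by
  obtain ⟨γ, hγ, hl⟩ := exists_curve_of_ccDist_lt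
    (h.trans_lt ((ENNReal.ofReal_lt_ofReal_iff (by linarith)).2 (lt_add_one ε)))
  exact hγ.abs_taylorDeriv_sub_le (by linarith) hl.le (by linarith)
    (fun i => by linarith [hy i]) J

theorem eq_of_ccDist_eq_zero {p q : JetSpace n k} (h : ccDist p q = 0) : p = q := by
  have hγ : ∀ ℓ : ℝ, 0 < ℓ → ∃ γ, IsHorizontalCurve γ p q ∧ curveLength γ ≤ ENNReal.ofReal ℓ := by
    intro ℓ hℓ
    obtain ⟨γ, hγ, hl⟩ := exists_curve_of_ccDist_lt (h.trans_lt (ENNReal.ofReal_pos.2 hℓ))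
    exact ⟨γ, hγ, hl.le⟩
  have h1 : p.1 = q.1 := by
    funext i
    refine (eq_of_abs_sub_le_all fun ℓ hℓ => ?_).symm
    obtain ⟨γ, hγ, hl⟩ := hγ ℓ hℓ
    simpa [hγ.target] using hγ.abs_fst_sub_le hℓ.le hl i 1 (by simp)
  refine Prod.ext h1 (funext fun J => ?_)
  set N : ℝ := Fintype.card (MultiIndex n k) * ((2 : ℝ) ^ k) ^ n with hN
  have hN0 : 0 ≤ N := by positivity
  refine (eq_of_abs_sub_le_all fun δ hδ => ?_).symm
  set ℓ := min 1 (δ / (N + 1)) with hℓdef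
  have hℓ : 0 < ℓ := lt_min one_pos (by positivity)
  obtain ⟨γ, hγ, hl⟩ := hγ ℓ hℓ
  have h2 := hγ.abs_taylorDeriv_sub_le hℓ.le hl (B := 2) (y := p.1) (by norm_num)
    (fun i => by
      have : ℓ ≤ 1 := min_le_left _ _
      simp only [sub_self, abs_zero]; linarith) J.1
  rw [taylorDeriv_self] at h2
  conv at h2 => lhs; rw [h1]
  rw [taylorDeriv_self] at h2
  refine h2.trans ?_
  calc N * ℓ ≤ (N + 1) * (δ / (N + 1)) :=
        mul_le_mul (by linarith) (min_le_right _ _) hℓ.le (by linarith)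
    _ = δ := by field_simp

/-! ### Discrete nets -/

/-- A maximal separated subset of a set `Z` which is `ε / 2`-dense. -/
theorem exists_net {Z : Set (JetSpace n k)} {ε : ℝ} (hε : 0 < ε)
    (hZ : ∀ p, ∃ z ∈ Z, ccDist p z ≤ ENNReal.ofReal (ε / 2)) :
    ∃ A ⊆ Z, IsDiscreteSubset A ∧ IsEpsDense ε A := by
  obtain ⟨A, hA⟩ := zorn_subset
    {S : Set (JetSpace n k) | S ⊆ Z ∧
      ∀ a ∈ S, ∀ b ∈ S, a ≠ b → ENNReal.ofReal (ε / 2) ≤ ccDist a b} (by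
    intro c hc hchain
    refine ⟨⋃₀ c, ⟨sUnion_subset fun S hS => (hc hS).1, ?_⟩, fun S hS => subset_sUnion_of_mem hS⟩
    rintro a ⟨S, hS, ha⟩ b ⟨T, hT, hb⟩ hab
    rcases hchain.total hS hT with h | h
    · exact (hc hT).2 a (h ha) b hb hab
    · exact (hc hS).2 a ha b (h hb) hab)
  have hsep := hA.prop.2
  refine ⟨A, hA.prop.1, fun p => ?_, fun p => ?_⟩
  · by_cases hp : ∃ a ∈ A, a ≠ p ∧ ccDist p a < ENNReal.ofReal (ε / 4)
    · obtain ⟨a, ha, hap, hlt⟩ := hp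
      have h0 : ccDist p a ≠ 0 := fun h => hap (eq_of_ccDist_eq_zero h).symm
      refine ⟨(ccDist p a).toReal, ENNReal.toReal_pos h0 hlt.ne_top, fun b hb hpb => ?_⟩
      rw [ENNReal.ofReal_toReal hlt.ne_top] at hpb
      by_cases hab : a = b
      · exact absurd hpb (by rw [hab]; exact lt_irrefl _)
      · have h1 := hsep a ha b hb hab
        have h2 := ccDist_triangle a p b
        rw [ccDist_comm a p] at h2
        have h3 : ccDist p a + ccDist p b < ENNReal.ofReal (ε / 4) + ENNReal.ofReal (ε / 4) :=
          ENNReal.add_lt_add hlt (hpb.trans hlt)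
        rw [← ENNReal.ofReal_add (by positivity) (by positivity),
          show ε / 4 + ε / 4 = ε / 2 by ring] at h3
        exact absurd (h1.trans h2) (not_le.2 h3)
    · push Not at hp
      refine ⟨ε / 4, by positivity, fun a ha hlt => ?_⟩
      by_contra hne
      exact absurd hlt (not_lt.2 (hp a ha hne))
  · obtain ⟨z, hz, hpz⟩ := hZ p
    by_cases hzA : ∃ a ∈ A, ccDist z a ≤ ENNReal.ofReal (ε / 2)
    · obtain ⟨a, ha, hza⟩ := hzA
      refine ⟨a, ha, (ccDist_triangle p z a).trans ((add_le_add hpz hza).trans_eq ?_)⟩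
      rw [← ENNReal.ofReal_add (by positivity) (by positivity), add_halves]
    · push Not at hzA
      have hins : insert z A ∈ {S : Set (JetSpace n k) | S ⊆ Z ∧
          ∀ a ∈ S, ∀ b ∈ S, a ≠ b → ENNReal.ofReal (ε / 2) ≤ ccDist a b} := by
        refine ⟨insert_subset hz hA.prop.1, ?_⟩
        rintro a (rfl | ha) b (rfl | hb) hab
        · exact absurd rfl hab
        · exact (hzA b hb).le
        · rw [ccDist_comm]; exact (hzA a ha).le
        · exact hsep a ha b hb hab
      have hzm : z ∈ A := hA.le_of_ge hins (subset_insert z A) (mem_insert z A)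
      exact absurd (hzA z hzm) (by rw [ccDist_self]; simp)

/-- The points with one `x`-coordinate in a dense set of reals are dense for `d_c`: move along
the jets of the Taylor polynomial. -/
theorem exists_near_of_dense (i : Fin n) {Q : Set ℝ} (hQ : Dense Q) {η : ℝ} (hη : 0 < η)
    (p : JetSpace n k) : ∃ z ∈ {z : JetSpace n k | z.1 i ∈ Q}, ccDist p z ≤ ENNReal.ofReal η := by
  set M : ℝ := √(n + Fintype.card (MultiIndex n k) * (n * (0 : ℝ)) ^ 2) with hM
  have hM0 : 0 ≤ M := Real.sqrt_nonneg _
  set δ : ℝ := η / (M + 1) with hδ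
  have hδ0 : 0 < δ := by positivity
  obtain ⟨c, hc, h1, h2⟩ := hQ.exists_between (lt_add_of_pos_right (p.1 i) hδ0)
  refine ⟨jet k (taylor p) (p.1 + Pi.single i (c - p.1 i)), ?_, ?_⟩
  · simpa [jet] using hc
  · have h := ccDist_jet_le (k := k) (contDiff_taylor p) p.1 (Pi.single i (c - p.1 i)) (C := 0)
      hδ0.le (fun j => ?_) (fun u _ l hl => ?_)
    · rw [jet_taylor_self] at h
      refine h.trans (ENNReal.ofReal_le_ofReal ?_)
      rw [← hM, hδ, div_mul_eq_mul_div, div_le_iff₀ (by positivity)]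
      nlinarith
    · by_cases hj : j = i
      · subst hj
        rw [Pi.single_eq_same, abs_of_pos (by linarith)]
        linarith
      · simpa [hj] using hδ0.le
    · rw [pdList_taylor_eq_zero p (by omega), abs_zero]

/-! ### Ranks and level sets of barycentric coordinates -/

/-- The `j`-th largest value of a nonnegative function with finite support, counted from `0`. -/
def rank {α : Type*} (v : α → ℝ) (j : ℕ) : ℝ := sInf {c | 0 ≤ c ∧ {p | c < v p}.ncard ≤ j}

/-- The points of the support at which `v` is at least its `j`-th largest value. If the `j`-th
largest value is larger than the next one, these are the `j + 1` largest coordinates. -/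
def levelSet {α : Type*} (v : α → ℝ) (j : ℕ) : Set α := {p | 0 < v p ∧ rank v j ≤ v p}

theorem levelSet_nonempty {α : Type*} {v : α → ℝ} (hfin : v.support.Finite) {p : α}
    (hp : 0 < v p) (j : ℕ) : (levelSet v j).Nonempty := by
  obtain ⟨q, hq, hmax⟩ := hfin.exists_maximalFor v _ ⟨p, hp.ne'⟩
  have hle : ∀ x, v x ≤ v q := by
    intro x
    by_contra! hx
    by_cases hx0 : v x = 0
    · have hqp : v q < v p := by linarith
      exact absurd (hmax (j := p) hp.ne' hqp.le) (not_le.2 hqp)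
    · exact absurd (hmax (j := x) hx0 hx.le) (not_le.2 hx)
  have hq0 : 0 < v q := hp.trans_le (hle p)
  refine ⟨q, hq0, csInf_le ⟨0, fun c hc => hc.1⟩ ⟨hq0.le, ?_⟩⟩
  have : {x | v q < v x} = ∅ := by
    ext x; simpa using hle x
  simp [this]

theorem rank_comp_equiv {α β : Type*} (e : α ≃ β) (v : β → ℝ) (j : ℕ) :
    rank (v ∘ e) j = rank v j := by
  unfold rank
  congr 1
  ext c
  have : {p | c < (v ∘ e) p} = e.symm '' {p | c < v p} := by
    rw [e.symm.image_eq_preimage_symm]; rfl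
  rw [mem_ofPred_eq, this, ncard_image_of_injective _ e.symm.injective]
  rfl

theorem levelSet_comp_equiv {α β : Type*} (e : α ≃ β) (v : β → ℝ) (j : ℕ) :
    levelSet v j = e '' levelSet (v ∘ e) j := by
  rw [e.image_eq_preimage_symm]
  ext p
  simp [levelSet, rank_comp_equiv]

variable {α : Type*} {m : ℕ}

/-- The values of `v` along an enumeration, continued by `0`. -/
def valAt (σ : Fin m → α) (v : α → ℝ) (j : ℕ) : ℝ := if h : j < m then v (σ ⟨j, h⟩) else 0

/-- The set of the first `j + 1` members of an enumeration. -/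
def initSet (σ : Fin m → α) (j : ℕ) : Set α := σ '' {i | (i : ℕ) ≤ j}

/-- `σ` lists, in the order of decreasing values, points containing the support of the
nonnegative function `v`. -/
structure IsSorting (σ : Fin m → α) (v : α → ℝ) : Prop where
  injective : Function.Injective σ
  nonneg : ∀ p, 0 ≤ v p
  eq_zero : ∀ p, p ∉ range σ → v p = 0
  antitone : Antitone (v ∘ σ)

theorem IsSorting.valAt_nonneg {σ : Fin m → α} {v : α → ℝ} (h : IsSorting σ v) (j : ℕ) :
    0 ≤ valAt σ v j := by
  unfold valAt
  split_ifs
  · exact h.nonneg _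
  · exact le_rfl

theorem IsSorting.valAt_antitone {σ : Fin m → α} {v : α → ℝ} (h : IsSorting σ v) :
    Antitone (valAt σ v) := by
  intro i j hij
  by_cases hj : j < m
  · have hi : i < m := lt_of_le_of_lt hij hj
    simp only [valAt, hi, hj, dif_pos]
    exact h.antitone hij
  · rw [valAt, dif_neg hj]; exact h.valAt_nonneg i

theorem IsSorting.rank_eq {σ : Fin m → α} {v : α → ℝ} (h : IsSorting σ v) (j : ℕ) :
    rank v j = valAt σ v j := by
  refine IsLeast.csInf_eq ⟨⟨h.valAt_nonneg j, ?_⟩, ?_⟩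
  · have hsub : {p | valAt σ v j < v p} ⊆ σ '' {i | (i : ℕ) < j} := by
      intro p hp
      have hp0 : v p ≠ 0 := ((h.valAt_nonneg j).trans_lt hp).ne'
      obtain ⟨i, rfl⟩ : p ∈ range σ := by
        by_contra hp'
        exact hp0 (h.eq_zero p hp')
      refine ⟨i, ?_, rfl⟩
      by_contra hij
      have h1 := h.valAt_antitone (not_lt.1 hij)
      rw [valAt, dif_pos i.2] at h1
      exact absurd hp (not_lt.2 h1)
    refine (ncard_le_ncard hsub (toFinite _)).trans ((ncard_image_le (toFinite _)).trans ?_)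
    rw [← ncard_image_of_injective _ Fin.val_injective]
    refine (ncard_le_ncard (t := (Finset.range j : Set ℕ)) ?_ (toFinite _)).trans_eq ?_
    · rintro _ ⟨i, hi, rfl⟩; simpa using hi
    · rw [ncard_coe_finset, Finset.card_range]
  · rintro c ⟨hc0, hc⟩
    by_contra! hlt
    have hj : j < m := by
      by_contra hj
      rw [valAt, dif_neg hj] at hlt
      linarith
    have hfin : {p | c < v p}.Finite := (finite_range σ).subset fun p hp => by
      by_contra hp'
      have := h.eq_zero p hp'
      have hp : c < v p := hp
      linarith
    have hsub : (fun i : Fin (j + 1) => σ ⟨i, by omega⟩) '' univ ⊆ {p | c < v p} := by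
      rintro _ ⟨i, -, rfl⟩
      have h1 := h.valAt_antitone (Nat.lt_succ_iff.1 i.2)
      have h2 : valAt σ v i = v (σ ⟨i, by omega⟩) := by rw [valAt, dif_pos]
      rw [h2] at h1
      exact hlt.trans_le h1
    have h3 := (ncard_le_ncard hsub hfin).trans hc
    rw [ncard_image_of_injective _ (fun a b hab => by
      have := h.injective hab
      simpa [Fin.ext_iff] using this), ncard_univ] at h3
    simp at h3

theorem IsSorting.levelSet_eq {σ : Fin m → α} {v : α → ℝ} (h : IsSorting σ v) {j : ℕ}
    (hj : valAt σ v (j + 1) < valAt σ v j) : levelSet v j = initSet σ j := by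
  have hj0 : 0 < valAt σ v j := (h.valAt_nonneg _).trans_lt hj
  have hval : ∀ i : Fin m, valAt σ v i = v (σ i) := fun i => by rw [valAt, dif_pos i.2]
  ext p
  constructor
  · rintro ⟨hp0, hp⟩
    rw [h.rank_eq] at hp
    obtain ⟨i, rfl⟩ : p ∈ range σ := by
      by_contra hp'
      exact hp0.ne' (h.eq_zero p hp')
    refine ⟨i, ?_, rfl⟩
    by_contra hij
    have h1 := h.valAt_antitone (Nat.succ_le_of_lt (not_le.1 (show ¬ (i : ℕ) ≤ j from hij)))
    rw [hval] at h1
    linarith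
  · rintro ⟨i, hi, rfl⟩
    have h1 := h.valAt_antitone (show (i : ℕ) ≤ j from hi)
    rw [hval] at h1
    exact ⟨hj0.trans_le h1, by rwa [h.rank_eq]⟩

/-! ### Interpolation of jets -/

/-- To every set of vertices of a simplex, seen as a vertex of the barycentric subdivision, a length
scale and a jet are attached. -/
structure Anchor (n k : ℕ) where
  /-- the size of the region in which the jet attached to the set is blended in -/
  scale : Set (JetSpace n k) → ℝ
  /-- the jet attached to the set -/
  rep : Set (JetSpace n k) → JetSpace n k

/-- The `j`-th coordinate, with the value `0` for `j ≥ n`. -/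
def coord (j : ℕ) (y : Fin n → ℝ) : ℝ := if h : j < n then y ⟨j, h⟩ else 0

/-- A smooth step function, with value `0` on `(-∞, 1/3]` and `1` on `[2/3, ∞)`. -/
def step (z : ℝ) : ℝ := Real.smoothTransition (3 * z - 1)

/-- The smooth function of the `j`-th coordinate that switches from `0` to `1` where this coordinate
exceeds that of the base point of `D.rep S` by `1/3` to `2/3` of `D.scale S`. -/
def cutoff (D : Anchor n k) (S : Set (JetSpace n k)) (j : ℕ) (y : Fin n → ℝ) : ℝ :=
  step ((coord j y - coord j (D.rep S).1) / D.scale S)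

/-- The function which blends the Taylor polynomials of the jets attached to `S 0`, …, `S j`: the
polynomial of `S (j + 1)` replaces the previous ones where the `j`-th coordinate is large. -/
def blend (D : Anchor n k) (S : ℕ → Set (JetSpace n k)) : ℕ → (Fin n → ℝ) → ℝ
  | 0 => taylor (D.rep (S 0))
  | j + 1 => fun y => blend D S j y +
      cutoff D (S (j + 1)) j y * (taylor (D.rep (S (j + 1))) y - blend D S j y)

/-- The `x`-coordinates of the image of the point with barycentric coordinates `v`. The `i`-th
coordinate is pushed from the affine interpolation towards the region where the jet of
`levelSet v (i + 1)` is used; the difference of successive ranks is, up to a factor, the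
barycentric coordinate of this set in the barycentric subdivision. With the factor `(n + 1) ^ 2` one
of the levels is pushed by at least its scale (`IsSorting.exists_gap`). -/
def place (D : Anchor n k) (v : JetSpace n k → ℝ) : Fin n → ℝ := fun i =>
  ∑ᶠ p, v p * p.1 i + D.scale (levelSet v (i + 1)) *
    ((n + 1) ^ 2 * (rank v (i + 1) - rank v (i + 2)))

/-- The interpolation of jets with barycentric coordinates `v`. -/
def interp (D : Anchor n k) (v : JetSpace n k → ℝ) : JetSpace n k :=
  jet k (blend D (levelSet v) n) (place D v)

/-- The scales lie in `[4 (ε + 1), R]` and the jet attached to a nonempty set is one of its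
members. As the base points of jets at distance at most `ε` differ by at most `ε + 1` in each
coordinate, a third of the scale exceeds these differences. -/
structure Anchor.Valid (D : Anchor n k) (ε R : ℝ) : Prop where
  le_scale : ∀ S, 4 * (ε + 1) ≤ D.scale S
  scale_le : ∀ S, D.scale S ≤ R
  rep_mem : ∀ S : Set (JetSpace n k), S.Nonempty → D.rep S ∈ S

theorem contDiff_step : ContDiff ℝ ∞ step :=
  Real.smoothTransition.contDiff.comp (by fun_prop)

theorem contDiff_cutoff (D : Anchor n k) (S : Set (JetSpace n k)) (j : ℕ) :
    ContDiff ℝ ∞ (cutoff D S j) := by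
  have h : ContDiff ℝ ∞ (coord j : (Fin n → ℝ) → ℝ) := by
    unfold coord
    split_ifs <;> fun_prop
  exact contDiff_step.comp ((h.sub contDiff_const).div_const _)

theorem contDiff_blend (D : Anchor n k) (S : ℕ → Set (JetSpace n k)) (j : ℕ) :
    ContDiff ℝ ∞ (blend D S j) := by
  induction j with
  | zero => exact contDiff_taylor _
  | succ j ih => exact ih.add ((contDiff_cutoff _ _ _).mul ((contDiff_taylor _).sub ih))

theorem cutoff_eventually_zero {D : Anchor n k} {S : Set (JetSpace n k)} {i : Fin n}
    {y : Fin n → ℝ} (hR : 0 < D.scale S) (h : y i - (D.rep S).1 i < D.scale S / 3) :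
    cutoff D S i =ᶠ[nhds y] fun _ => 0 := by
  have hc : Continuous fun z : Fin n → ℝ => z i - (D.rep S).1 i := by fun_prop
  filter_upwards [(isOpen_lt hc continuous_const).mem_nhds h] with z hz
  have hz : z i - (D.rep S).1 i < D.scale S / 3 := hz
  simp only [cutoff, coord, i.2, dif_pos, Fin.eta]
  refine Real.smoothTransition.zero_of_nonpos ?_
  have : (z i - (D.rep S).1 i) / D.scale S ≤ 1 / 3 := by
    rw [div_le_iff₀ hR]; linarith
  linarith

theorem cutoff_eventually_one {D : Anchor n k} {S : Set (JetSpace n k)} {i : Fin n}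
    {y : Fin n → ℝ} (hR : 0 < D.scale S) (h : 2 / 3 * D.scale S < y i - (D.rep S).1 i) :
    cutoff D S i =ᶠ[nhds y] fun _ => 1 := by
  have hc : Continuous fun z : Fin n → ℝ => z i - (D.rep S).1 i := by fun_prop
  filter_upwards [(isOpen_lt continuous_const hc).mem_nhds h] with z hz
  have hz : 2 / 3 * D.scale S < z i - (D.rep S).1 i := hz
  simp only [cutoff, coord, i.2, dif_pos, Fin.eta]
  refine Real.smoothTransition.one_of_one_le ?_
  have : 2 / 3 ≤ (z i - (D.rep S).1 i) / D.scale S := by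
    rw [le_div_iff₀ hR]; linarith
  linarith

/-- Two sequences of sets give the same blend near `y` if they agree at all levels `j` whose weight
`g j` is not zero: the levels of weight zero do not contribute near `y`, and a level of weight at
least one erases the lower ones. -/
theorem blend_congr {D : Anchor n k} {T T' : ℕ → Set (JetSpace n k)} {y : Fin n → ℝ} {g : ℕ → ℝ}
    (heq : ∀ j, g j ≠ 0 → T j = T' j)
    (hzero : ∀ i : Fin n, g (i + 1) = 0 →
      cutoff D (T (i + 1)) i =ᶠ[nhds y] (fun _ => 0) ∧
      cutoff D (T' (i + 1)) i =ᶠ[nhds y] (fun _ => 0))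
    (hone : ∀ i : Fin n, 1 ≤ g (i + 1) → cutoff D (T (i + 1)) i =ᶠ[nhds y] fun _ => 1)
    (hex : ∃ j ≤ n, 1 ≤ g j) : blend D T n =ᶠ[nhds y] blend D T' n := by
  suffices h : ∀ m ≤ n, (∃ j ≤ m, 1 ≤ g j) → blend D T m =ᶠ[nhds y] blend D T' m from
    h n le_rfl hex
  intro m
  induction m with
  | zero =>
    rintro - ⟨j, hj, hg⟩
    obtain rfl : j = 0 := by omega
    rw [blend, blend, heq 0 (by linarith)]
  | succ m ih =>
    rintro hm ⟨j, hj, hg⟩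
    by_cases h1 : 1 ≤ g (m + 1)
    · have e := heq (m + 1) (by linarith)
      filter_upwards [hone ⟨m, hm⟩ h1] with z hz
      simp only [blend, ← e, hz, one_mul, add_sub_cancel]
    · have hjm : j ≤ m := by
        rcases Nat.lt_or_ge m j with h | h
        · obtain rfl : j = m + 1 := by omega
          exact absurd hg h1
        · exact h
      have ih' := ih (by omega) ⟨j, hjm, hg⟩
      by_cases h0 : g (m + 1) = 0
      · obtain ⟨z1, z2⟩ := hzero ⟨m, hm⟩ h0
        filter_upwards [z1, z2, ih'] with z hz1 hz2 hz
        simp only [blend, hz1, hz2, hz, zero_mul]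
      · have e := heq (m + 1) h0
        filter_upwards [ih'] with z hz
        simp only [blend, ← e, hz]

/-! ### The interpolation in a chamber of the barycentric subdivision -/

/-- The formula for `place` on the barycentric coordinates sorted by `σ`, where it is affine. -/
def placeOn (D : Anchor n k) (σ : Fin m → JetSpace n k) (v : JetSpace n k → ℝ) : Fin n → ℝ :=
  fun i => ∑ l, v (σ l) * (σ l).1 i + D.scale (initSet σ (i + 1)) *
    ((n + 1) ^ 2 * (valAt σ v (i + 1) - valAt σ v (i + 2)))

theorem IsSorting.place_eq {σ : Fin m → JetSpace n k} {v : JetSpace n k → ℝ} (h : IsSorting σ v)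
    (D : Anchor n k) : place D v = placeOn D σ v := by
  funext i
  unfold place placeOn
  congr 1
  · classical
    rw [finsum_eq_sum_of_support_subset (s := Finset.univ.image σ), Finset.sum_image]
    · exact fun a _ b _ hab => h.injective hab
    · intro p hp
      by_contra hp'
      exact hp (by simp [h.eq_zero p (by simpa using hp')])
  · rw [h.rank_eq, h.rank_eq]
    rcases (h.valAt_antitone (Nat.le_succ ((i : ℕ) + 1))).lt_or_eq with hlt | heq
    · rw [h.levelSet_eq hlt]
    · have : valAt σ v (i + 1) - valAt σ v (i + 2) = 0 := by
        rw [sub_eq_zero]; exact heq.symm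
      rw [this]; simp

/-- One of the gaps between successive values is not small. -/
theorem IsSorting.exists_gap {σ : Fin m → α} {v : α → ℝ}
    (h : IsSorting σ v) (hm : m ≤ n + 1) (hsum : ∑ l, v (σ l) = 1) :
    ∃ j ≤ n, 1 ≤ ((n : ℝ) + 1) ^ 2 * (valAt σ v j - valAt σ v (j + 1)) := by
  by_contra! hcon
  have hK : (0 : ℝ) < ((n : ℝ) + 1) ^ 2 := by positivity
  have h1 : ∑ j ∈ Finset.range (n + 1), (valAt σ v j - valAt σ v (j + 1)) <
      ∑ _j ∈ Finset.range (n + 1), 1 / ((n : ℝ) + 1) ^ 2 := by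
    refine Finset.sum_lt_sum_of_nonempty (by simp) fun j hj => ?_
    rw [lt_div_iff₀ hK, mul_comm]
    exact hcon j (by simpa [Nat.lt_succ_iff] using hj)
  rw [Finset.sum_range_sub' (valAt σ v)] at h1
  have h2 : valAt σ v (n + 1) = 0 := by rw [valAt, dif_neg (by omega)]
  have h3 : (1 : ℝ) ≤ (n + 1) * valAt σ v 0 := by
    refine hsum.symm.le.trans
      ((Finset.sum_le_card_nsmul _ _ (valAt σ v 0) fun l _ => ?_).trans ?_)
    · have := h.valAt_antitone (Nat.zero_le l)
      rwa [valAt, dif_pos l.2] at this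
    · simp only [Finset.card_univ, Fintype.card_fin, nsmul_eq_mul]
      refine mul_le_mul_of_nonneg_right ?_ (h.valAt_nonneg 0)
      exact_mod_cast hm
  simp only [Finset.sum_const, Finset.card_range, nsmul_eq_mul] at h1
  rw [h2, sub_zero] at h1
  have h4 : ((n : ℝ) + 1) * valAt σ v 0 < (n + 1) * (((n + 1 : ℕ) : ℝ) * (1 / (n + 1) ^ 2)) :=
    mul_lt_mul_of_pos_left h1 (by positivity)
  have h5 : ((n : ℝ) + 1) * (((n + 1 : ℕ) : ℝ) * (1 / (n + 1) ^ 2)) = 1 := by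
    push_cast; field_simp
  linarith

theorem abs_sum_mul_sub_le {σ : Fin m → JetSpace n k} {v : JetSpace n k → ℝ}
    (h : IsSorting σ v) (hsum : ∑ l, v (σ l) = 1) {E : ℝ} {a : JetSpace n k} {i : Fin n}
    (ha : ∀ l, |(σ l).1 i - a.1 i| ≤ E) : |∑ l, v (σ l) * (σ l).1 i - a.1 i| ≤ E := by
  have : ∑ l, v (σ l) * (σ l).1 i - a.1 i = ∑ l, v (σ l) * ((σ l).1 i - a.1 i) := by
    simp only [mul_sub, Finset.sum_sub_distrib, ← Finset.sum_mul, hsum, one_mul]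
  rw [this]
  refine (Finset.abs_sum_le_sum_abs _ _).trans ?_
  calc ∑ l, |v (σ l) * ((σ l).1 i - a.1 i)| ≤ ∑ l, v (σ l) * E := by
        refine Finset.sum_le_sum fun l _ => ?_
        rw [abs_mul, abs_of_nonneg (h.nonneg _)]
        exact mul_le_mul_of_nonneg_left (ha l) (h.nonneg _)
    _ = E := by rw [← Finset.sum_mul, hsum, one_mul]

theorem IsSorting.levelSet_subset {σ : Fin m → α} {v : α → ℝ} (h : IsSorting σ v)
    (j : ℕ) : levelSet v j ⊆ range σ := by
  intro p hp
  by_contra hp'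
  exact hp.1.ne' (h.eq_zero p hp')

theorem IsSorting.exists_pos {σ : Fin m → α} {v : α → ℝ} (h : IsSorting σ v)
    (hsum : ∑ l, v (σ l) = 1) : ∃ l, 0 < v (σ l) := by
  by_contra! hcon
  have : ∑ l, v (σ l) = 0 := Finset.sum_eq_zero fun l _ => le_antisymm (hcon l) (h.nonneg _)
  linarith

theorem IsSorting.levelSet_nonempty {σ : Fin m → α} {v : α → ℝ} (h : IsSorting σ v)
    (hsum : ∑ l, v (σ l) = 1) (j : ℕ) : (levelSet v j).Nonempty := by
  obtain ⟨l, hl⟩ := h.exists_pos hsum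
  refine JetCarnot.levelSet_nonempty ((finite_range σ).subset fun p hp => ?_) hl j
  by_contra hp'
  exact hp (h.eq_zero p hp')

theorem initSet_nonempty (σ : Fin m → α) (hm : 0 < m) (j : ℕ) :
    (initSet σ j).Nonempty :=
  ⟨_, ⟨0, hm⟩, Nat.zero_le j, rfl⟩

theorem initSet_subset (σ : Fin m → α) (j : ℕ) : initSet σ j ⊆ range σ :=
  image_subset_range _ _

/-- In a chamber of the barycentric subdivision the interpolation is the jet of one smooth function
along an affine map. -/
theorem IsSorting.interp_eq {σ : Fin m → JetSpace n k} {v : JetSpace n k → ℝ} (h : IsSorting σ v)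
    (hm : m ≤ n + 1) (hsum : ∑ l, v (σ l) = 1) {D : Anchor n k} {ε R : ℝ} (hε : 0 < ε)
    (hD : D.Valid ε R) (hσ : ∀ l l', ccDist (σ l) (σ l') ≤ ENNReal.ofReal ε) :
    interp D v = jet k (blend D (initSet σ) n) (placeOn D σ v) := by
  rw [interp, h.place_eq]
  have hm0 : 0 < m := by
    obtain ⟨l, -⟩ := h.exists_pos hsum
    exact l.pos
  have hpos : ∀ S, 0 < D.scale S := fun S => lt_of_lt_of_le (by linarith) (hD.le_scale S)
  have hrange : ∀ S : Set (JetSpace n k), S.Nonempty → S ⊆ range σ → ∀ i : Fin n,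
      |∑ l, v (σ l) * (σ l).1 i - (D.rep S).1 i| ≤ ε + 1 := by
    intro S hS hSσ i
    obtain ⟨l', hl'⟩ := hSσ (hD.rep_mem S hS)
    refine abs_sum_mul_sub_le h hsum fun l => ?_
    rw [← hl']
    exact abs_fst_sub_le_of_ccDist_le hε (hσ l' l) i
  have hgap : ∀ j, 0 ≤ valAt σ v j - valAt σ v (j + 1) := fun j =>
    sub_nonneg.2 (h.valAt_antitone (Nat.le_succ j))
  have heq : ∀ j, ((n : ℝ) + 1) ^ 2 * (valAt σ v j - valAt σ v (j + 1)) ≠ 0 →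
      levelSet v j = initSet σ j := by
    intro j hj
    refine h.levelSet_eq (sub_pos.1 ((hgap j).lt_of_ne fun h0 => hj ?_))
    rw [← h0, mul_zero]
  refine jet_congr (blend_congr heq (fun i hi => ?_) (fun i hi => ?_) (h.exists_gap hm hsum))
  · have hp : placeOn D σ v i = ∑ l, v (σ l) * (σ l).1 i := by
      rw [placeOn, hi, mul_zero, add_zero]
    constructor
    · refine cutoff_eventually_zero (hpos _) ?_
      have h1 := hrange _ (h.levelSet_nonempty hsum (i + 1)) (h.levelSet_subset (i + 1)) i
      have h2 := hD.le_scale (levelSet v (i + 1))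
      rw [hp]
      linarith [(abs_le.1 h1).2]
    · refine cutoff_eventually_zero (hpos _) ?_
      have h1 := hrange _ (initSet_nonempty σ hm0 (i + 1)) (initSet_subset σ (i + 1)) i
      have h2 := hD.le_scale (initSet σ (i + 1))
      rw [hp]
      linarith [(abs_le.1 h1).2]
  · refine cutoff_eventually_one (hpos _) ?_
    have h1 := hrange _ (h.levelSet_nonempty hsum (i + 1)) (h.levelSet_subset (i + 1)) i
    have h2 := hD.le_scale (levelSet v (i + 1))
    have h3 := heq (i + 1) (by linarith)
    have h4 : D.scale (levelSet v (i + 1)) ≤ D.scale (initSet σ (i + 1)) *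
        ((n + 1) ^ 2 * (valAt σ v (i + 1) - valAt σ v (i + 2))) := by
      rw [← h3]
      exact le_mul_of_one_le_right (hpos _).le hi
    simp only [placeOn]
    linarith [(abs_le.1 h1).1]

/-! ### Bounds for the blended functions -/

theorem exists_iteratedDeriv_step_le (m : ℕ) (B : ℝ) :
    ∃ C, 0 ≤ C ∧ ∀ a ≤ m, ∀ z, |z| ≤ B → |iteratedDeriv a step z| ≤ C := by
  have h : ∀ a : ℕ, ∃ C, ∀ z ∈ Icc (-B) B, ‖iteratedDeriv a step z‖ ≤ C := fun a =>
    isCompact_Icc.exists_bound_of_continuousOn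
      (contDiff_step.continuous_iteratedDeriv a (by exact_mod_cast le_top)).continuousOn
  choose C hC using h
  refine ⟨∑ a ∈ Finset.range (m + 1), |C a|, Finset.sum_nonneg fun _ _ => abs_nonneg _,
    fun a ha z hz => ?_⟩
  refine ((hC a z (abs_le.1 hz)).trans (le_abs_self _)).trans ?_
  exact Finset.single_le_sum (f := fun a => |C a|) (fun _ _ => abs_nonneg _)
    (Finset.mem_range.2 (Nat.lt_succ_of_le ha))

/-- Up to the Taylor polynomial of one of the jets, a blend of jets at bounded mutual distance
is bounded near the base points, together with its derivatives. -/
theorem exists_blend_derivBound (n k : ℕ) {ε B : ℝ} (hε : 0 < ε) (hB : 0 ≤ B) (R : ℝ) (j : ℕ)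
    (hj : j ≤ n) :
    ∃ C, 0 ≤ C ∧ ∀ (D : Anchor n k), D.Valid ε R → ∀ (a : JetSpace n k)
      (S : ℕ → Set (JetSpace n k)),
      (∀ j, ccDist a (D.rep (S j)) ≤ ENNReal.ofReal ε) →
      DerivBound {y | ∀ i, |y i - a.1 i| ≤ B} (k + 1) C fun y => blend D S j y - taylor a y := by
  set C₀ : ℝ := Fintype.card (MultiIndex n k) * ((B + (ε + 1)) ^ k) ^ n * (ε + 1) with hC₀
  have hC₀0 : 0 ≤ C₀ := by positivity
  have htay : ∀ a b : JetSpace n k, ccDist a b ≤ ENNReal.ofReal ε →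
      DerivBound {y | ∀ i, |y i - a.1 i| ≤ B} (k + 1) C₀ fun y => taylor b y - taylor a y := by
    intro a b hab l _ y hy
    rw [pdList_sub (contDiff_taylor b) (contDiff_taylor a), pdList_taylor, pdList_taylor]
    exact abs_taylorDeriv_sub_le_of_ccDist_le hε hB hab hy _
  induction j with
  | zero => exact ⟨C₀, hC₀0, fun D _ a S hS => htay a _ (hS 0)⟩
  | succ j ih =>
    obtain ⟨C, hC, hblend⟩ := ih (by omega)
    obtain ⟨C', hC', hstep⟩ := exists_iteratedDeriv_step_le (k + 1) (B + (ε + 1))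
    refine ⟨C + 2 ^ (k + 1) * (C' * (C₀ + C)), by positivity, fun D hD a S hS => ?_⟩
    have h1 := hblend D hD a S hS
    have h2 := htay a _ (hS (j + 1))
    have s1 := (contDiff_blend D S j).sub (contDiff_taylor a)
    have s2 := (contDiff_taylor (D.rep (S (j + 1)))).sub (contDiff_taylor a)
    have h3 : DerivBound {y | ∀ i, |y i - a.1 i| ≤ B} (k + 1) C' (cutoff D (S (j + 1)) j) := by
      intro l hl y hy
      have hR : 1 ≤ D.scale (S (j + 1)) := by linarith [hD.le_scale (S (j + 1))]
      have e : cutoff D (S (j + 1)) j = fun y => step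
          ((y ⟨j, hj⟩ - (D.rep (S (j + 1))).1 ⟨j, hj⟩) / D.scale (S (j + 1))) := by
        funext y
        simp only [cutoff, coord, show j < n from hj, dif_pos]
      rw [e]
      refine (abs_pdList_coord_le contDiff_step _ _ _ hR l y).trans (hstep _ hl _ ?_)
      rw [abs_div, abs_of_pos (by linarith : 0 < D.scale (S (j + 1)))]
      refine (div_le_self (abs_nonneg _) hR).trans ?_
      have h4 := abs_fst_sub_le_of_ccDist_le hε (hS (j + 1)) ⟨j, hj⟩
      have h5 := abs_sub_le (y ⟨j, hj⟩) (a.1 ⟨j, hj⟩) ((D.rep (S (j + 1))).1 ⟨j, hj⟩)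
      rw [abs_sub_comm (a.1 _)] at h5
      linarith [hy ⟨j, hj⟩]
    have h4 := h1.add s1 ((contDiff_cutoff D (S (j + 1)) j).mul (s2.sub s1))
      (h3.mul hC' (by positivity) (contDiff_cutoff D (S (j + 1)) j) (s2.sub s1) (h2.sub s2 s1 h1))
    convert h4 using 1
    funext y
    simp only [blend]
    ring

/-! ### The interpolation is Lipschitz on simplices -/

theorem abs_valAt_sub_le (σ : Fin m → α) (v w : α → ℝ) (j : ℕ) :
    |valAt σ w j - valAt σ v j| ≤ ∑ l, |w (σ l) - v (σ l)| := by
  unfold valAt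
  split_ifs with h
  · exact Finset.single_le_sum (f := fun l => |w (σ l) - v (σ l)|) (fun _ _ => abs_nonneg _)
      (Finset.mem_univ (⟨j, h⟩ : Fin m))
  · simpa using Finset.sum_nonneg fun l _ => abs_nonneg (w (σ l) - v (σ l))

theorem exists_lipschitz_of_isSorting (n k : ℕ) {ε : ℝ} (hε : 0 < ε) (R : ℝ) :
    ∃ ρ, 0 ≤ ρ ∧ ∀ (D : Anchor n k), D.Valid ε R → ∀ (m : ℕ), m ≤ n + 1 →
      ∀ (σ : Fin m → JetSpace n k), (∀ l l', ccDist (σ l) (σ l') ≤ ENNReal.ofReal ε) →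
      ∀ v w : JetSpace n k → ℝ, IsSorting σ v → IsSorting σ w →
      ∑ l, v (σ l) = 1 → ∑ l, w (σ l) = 1 →
      ccDist (interp D v) (interp D w) ≤ ENNReal.ofReal (ρ * ∑ l, |w (σ l) - v (σ l)|) := by
  by_cases hR : 0 ≤ R
  swap
  · exact ⟨0, le_rfl, fun D hD => absurd (hD.le_scale ∅) (not_le.2 (by
      linarith [hD.scale_le ∅]))⟩
  set K : ℝ := ((n : ℝ) + 1) ^ 2 with hK
  have hK0 : 0 ≤ K := by positivity
  obtain ⟨C, hC, hblend⟩ := exists_blend_derivBound n k (B := ε + 1 + R * K) hε (by positivity) R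
    n le_rfl
  refine ⟨(ε + 1 + 2 * R * K) * √(n + Fintype.card (MultiIndex n k) * (n * C) ^ 2),
    by positivity, ?_⟩
  intro D hD m hm σ hσ v w hv hw hvs hws
  rw [hv.interp_eq hm hvs hε hD hσ, hw.interp_eq hm hws hε hD hσ]
  have hm0 : 0 < m := by
    obtain ⟨l, -⟩ := hv.exists_pos hvs
    exact l.pos
  set a := σ ⟨0, hm0⟩ with ha
  set N := ∑ l, |w (σ l) - v (σ l)| with hN
  have hN0 : 0 ≤ N := Finset.sum_nonneg fun _ _ => abs_nonneg _
  have hcoord : ∀ l (i : Fin n), |(σ l).1 i - a.1 i| ≤ ε + 1 := fun l i =>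
    abs_fst_sub_le_of_ccDist_le hε (hσ _ l) i
  have hscale : ∀ S, 0 ≤ D.scale S := fun S => le_trans (by linarith) (hD.le_scale S)
  have hd : ∀ i, |(placeOn D σ w - placeOn D σ v) i| ≤ (ε + 1 + 2 * R * K) * N := by
    intro i
    have e : (placeOn D σ w - placeOn D σ v) i =
        ∑ l, (w (σ l) - v (σ l)) * ((σ l).1 i - a.1 i) + D.scale (initSet σ (i + 1)) * (K *
          ((valAt σ w (i + 1) - valAt σ v (i + 1)) - (valAt σ w (i + 2) - valAt σ v (i + 2)))) := by
      have e1 : ∑ l, (w (σ l) - v (σ l)) * ((σ l).1 i - a.1 i) =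
          ∑ l, w (σ l) * (σ l).1 i - ∑ l, v (σ l) * (σ l).1 i := by
        simp only [mul_sub, sub_mul, Finset.sum_sub_distrib, ← Finset.sum_mul, hvs, hws]
        ring
      simp only [Pi.sub_apply, placeOn, e1]
      ring
    have h1 : |∑ l, (w (σ l) - v (σ l)) * ((σ l).1 i - a.1 i)| ≤ (ε + 1) * N := by
      refine (Finset.abs_sum_le_sum_abs _ _).trans ?_
      rw [hN, Finset.mul_sum]
      refine Finset.sum_le_sum fun l _ => ?_
      rw [abs_mul, mul_comm]
      exact mul_le_mul_of_nonneg_right (hcoord l i) (abs_nonneg _)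
    have h2 : |(valAt σ w (i + 1) - valAt σ v (i + 1)) -
        (valAt σ w (i + 2) - valAt σ v (i + 2))| ≤ 2 * N := by
      refine (abs_sub _ _).trans ?_
      linarith [abs_valAt_sub_le σ v w (i + 1), abs_valAt_sub_le σ v w (i + 2)]
    rw [e]
    refine (abs_add_le _ _).trans ?_
    rw [abs_mul, abs_mul, abs_of_nonneg (hscale _), abs_of_nonneg hK0]
    have h3 : D.scale (initSet σ (i + 1)) * (K * |(valAt σ w (i + 1) - valAt σ v (i + 1)) -
        (valAt σ w (i + 2) - valAt σ v (i + 2))|) ≤ R * (K * (2 * N)) :=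
      mul_le_mul (hD.scale_le _) (mul_le_mul_of_nonneg_left h2 hK0) (by positivity) hR
    linarith
  have hplace : ∀ u, IsSorting σ u → ∑ l, u (σ l) = 1 → ∀ i,
      |placeOn D σ u i - a.1 i| ≤ ε + 1 + R * K := by
    intro u hu hus i
    have h1 := abs_sum_mul_sub_le hu hus (i := i) (fun l => hcoord l i)
    have h2 : 0 ≤ valAt σ u (i + 1) - valAt σ u (i + 2) :=
      sub_nonneg.2 (hu.valAt_antitone (Nat.le_succ _))
    have h3 : valAt σ u (i + 1) ≤ 1 := by
      unfold valAt
      split_ifs with h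
      · rw [← hus]
        exact Finset.single_le_sum (f := fun l => u (σ l)) (fun _ _ => hu.nonneg _)
          (Finset.mem_univ _)
      · exact zero_le_one
    have h4 := hu.valAt_nonneg (i + 2)
    have h5 : D.scale (initSet σ (i + 1)) *
        (K * (valAt σ u (i + 1) - valAt σ u (i + 2))) ≤ R * (K * 1) :=
      mul_le_mul (hD.scale_le _) (mul_le_mul_of_nonneg_left (by linarith) hK0) (by positivity) hR
    have h6 : 0 ≤ D.scale (initSet σ (i + 1)) *
        (K * (valAt σ u (i + 1) - valAt σ u (i + 2))) :=
      mul_nonneg (hscale _) (by positivity)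
    simp only [placeOn, ← hK]
    rw [abs_le] at h1 ⊢
    constructor <;> nlinarith [mul_nonneg hR hK0]
  have hbound := hblend D hD a (initSet σ) fun j => by
    obtain ⟨l, hl⟩ := initSet_subset σ j (hD.rep_mem _ (initSet_nonempty σ hm0 j))
    rw [← hl]
    exact hσ _ l
  have key := ccDist_jet_le (k := k) (C := C) (contDiff_blend D (initSet σ) n) (placeOn D σ v)
    (placeOn D σ w - placeOn D σ v) (δ := (ε + 1 + 2 * R * K) * N) (by positivity) hd ?_
  · rw [add_sub_cancel] at key
    refine key.trans_eq (congrArg _ ?_)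
    ring
  · intro u hu l hl
    have h := hbound l hl.le (placeOn D σ v + u • (placeOn D σ w - placeOn D σ v)) fun i => ?_
    · rw [pdList_sub (contDiff_blend D _ n) (contDiff_taylor a)] at h
      simpa [pdList_taylor_eq_zero a (show k < l.length by omega)] using h
    · have h1 := abs_le.1 (hplace v hv hvs i)
      have h2 := abs_le.1 (hplace w hw hws i)
      simp only [Pi.add_apply, Pi.smul_apply, Pi.sub_apply, smul_eq_mul]
      have e : placeOn D σ v i + u * (placeOn D σ w i - placeOn D σ v i) - a.1 i =
        (1 - u) * (placeOn D σ v i - a.1 i) + u * (placeOn D σ w i - a.1 i) := by ring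
      rw [e, abs_le]
      have hu1 : 0 ≤ 1 - u := by linarith [hu.2]
      constructor
      · nlinarith [mul_le_mul_of_nonneg_left h1.1 hu1, mul_le_mul_of_nonneg_left h2.1 hu.1]
      · nlinarith [mul_le_mul_of_nonneg_left h1.2 hu1, mul_le_mul_of_nonneg_left h2.2 hu.1]

/-- `v` is the family of barycentric coordinates of a point of the simplex with vertex set `s`. -/
structure IsBary (s : Finset α) (v : α → ℝ) : Prop where
  nonneg : ∀ p, 0 ≤ v p
  eq_zero : ∀ p, p ∉ s → v p = 0
  sum_eq : ∑ p ∈ s, v p = 1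

/-- Two points of a simplex on the same side of all the hyperplanes `v a = v b` lie in a common
chamber of the barycentric subdivision. -/
theorem exists_common_sorting {s : Finset α} {v w : α → ℝ} (hv : IsBary s v)
    (hw : IsBary s w) (h : ∀ a ∈ s, ∀ b ∈ s, 0 ≤ (v a - v b) * (w a - w b)) :
    ∃ σ : Fin s.card → α, IsSorting σ v ∧ IsSorting σ w ∧ (∀ l, σ l ∈ s) ∧
      ∀ g : α → ℝ, ∑ l, g (σ l) = ∑ p ∈ s, g p := by
  let e : Fin s.card ≃ s := s.equivFin.symm
  let u : Fin s.card → ℝ := fun i => -(v (e i) + w (e i))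
  let τ : Fin s.card ≃ s := (Tuple.sort u).trans e
  let σ : Fin s.card → α := fun l => (τ l).1
  have hmem : ∀ l, σ l ∈ s := fun l => (τ l).2
  have hmono : ∀ i j, i ≤ j → v (σ j) + w (σ j) ≤ v (σ i) + w (σ i) := fun i j hij =>
    neg_le_neg_iff.1 (Tuple.monotone_sort u hij)
  have hinj : Function.Injective σ := Subtype.val_injective.comp τ.injective
  have hoff : ∀ p, p ∉ range σ → p ∉ s := fun p hp hps =>
    hp ⟨τ.symm ⟨p, hps⟩, by simp [σ]⟩
  refine ⟨σ, ⟨hinj, hv.nonneg, fun p hp => hv.eq_zero p (hoff p hp), fun i j hij => ?_⟩,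
    ⟨hinj, hw.nonneg, fun p hp => hw.eq_zero p (hoff p hp), fun i j hij => ?_⟩, hmem, fun g => ?_⟩
  · have h1 := hmono i j hij
    have h2 := h _ (hmem i) _ (hmem j)
    simp only [Function.comp]
    by_contra! hlt
    nlinarith
  · have h1 := hmono i j hij
    have h2 := h _ (hmem i) _ (hmem j)
    simp only [Function.comp]
    by_contra! hlt
    nlinarith
  · rw [← Finset.sum_coe_sort s g]
    exact Equiv.sum_comp τ fun p : s => g p

theorem IsBary.lineMap {s : Finset α} {v w : α → ℝ} (hv : IsBary s v)
    (hw : IsBary s w) {c : ℝ} (hc : c ∈ Icc (0 : ℝ) 1) :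
    IsBary s fun p => (1 - c) * v p + c * w p := by
  have hc1 : 0 ≤ 1 - c := by linarith [hc.2]
  refine ⟨fun p => ?_, fun p hp => ?_, ?_⟩
  · exact add_nonneg (mul_nonneg hc1 (hv.nonneg p)) (mul_nonneg hc.1 (hw.nonneg p))
  · simp [hv.eq_zero p hp, hw.eq_zero p hp]
  · rw [Finset.sum_add_distrib, ← Finset.mul_sum, ← Finset.mul_sum, hv.sum_eq, hw.sum_eq]
    ring

/-- A map which is Lipschitz on the chambers of the barycentric subdivision is Lipschitz on the
simplex: segments are cut successively at the hyperplanes `v a = v b`. -/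
theorem ccDist_le_of_chambers {s : Finset α} {ρ : ℝ} (hρ : 0 ≤ ρ)
    {G : (α → ℝ) → JetSpace n k}
    (hG : ∀ v w, IsBary s v → IsBary s w →
      (∀ a ∈ s, ∀ b ∈ s, 0 ≤ (v a - v b) * (w a - w b)) →
      ccDist (G v) (G w) ≤ ENNReal.ofReal (ρ * ∑ p ∈ s, |w p - v p|)) :
    ∀ v w, IsBary s v → IsBary s w →
      ccDist (G v) (G w) ≤ ENNReal.ofReal (ρ * ∑ p ∈ s, |w p - v p|) := by
  classical
  suffices h : ∀ P : Finset (α × α), ∀ v w, IsBary s v → IsBary s w →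
      (∀ a ∈ s, ∀ b ∈ s, (a, b) ∉ P → 0 ≤ (v a - v b) * (w a - w b)) →
      ccDist (G v) (G w) ≤ ENNReal.ofReal (ρ * ∑ p ∈ s, |w p - v p|) from
    fun v w hv hw => h (s ×ˢ s) v w hv hw fun a ha b hb hab =>
      absurd (Finset.mk_mem_product ha hb) hab
  intro P
  induction P using Finset.induction_on with
  | empty => exact fun v w hv hw h => hG v w hv hw fun a ha b hb => h a ha b hb (by simp)
  | insert ab P _ ih =>
    obtain ⟨a₀, b₀⟩ := ab
    intro v w hv hw h
    by_cases h0 : 0 ≤ (v a₀ - v b₀) * (w a₀ - w b₀)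
    · refine ih v w hv hw fun a ha b hb hab => ?_
      by_cases hab' : (a, b) = (a₀, b₀)
      · obtain ⟨rfl, rfl⟩ := Prod.mk.inj hab'
        exact h0
      · exact h a ha b hb (by rw [Finset.mem_insert, not_or]; exact ⟨hab', hab⟩)
    · rw [not_le] at h0
      -- the point where the segment from `v` to `w` meets the hyperplane
      set x := v a₀ - v b₀ with hx
      set x' := w a₀ - w b₀ with hx'
      have hxx : x - x' ≠ 0 := by
        intro h1
        have : x = x' := by linarith
        rw [← this] at h0
        nlinarith [mul_self_nonneg x]
      set c := x / (x - x') with hc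
      have hc01 : c ∈ Icc (0 : ℝ) 1 := by
        have e : c = (x * (x - x')) / (x - x') ^ 2 := by rw [hc]; field_simp
        have hpos : 0 < (x - x') ^ 2 := by positivity
        constructor
        · rw [e]; exact div_nonneg (by nlinarith) hpos.le
        · rw [e, div_le_one hpos]; nlinarith [mul_self_nonneg x']
      set z : α → ℝ := fun p => (1 - c) * v p + c * w p with hz
      have hzb : IsBary s z := hv.lineMap hw hc01
      have hz0 : z a₀ - z b₀ = 0 := by
        have : z a₀ - z b₀ = x - c * (x - x') := by simp only [hz, hx, hx']; ring
        rw [this, hc]; field_simp; ring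
      have hc1 : 0 ≤ 1 - c := by linarith [hc01.2]
      have hvz : ∀ a ∈ s, ∀ b ∈ s, (a, b) ∉ P → 0 ≤ (v a - v b) * (z a - z b) := by
        intro a ha b hb hab
        by_cases hab' : (a, b) = (a₀, b₀)
        · obtain ⟨rfl, rfl⟩ := Prod.mk.inj hab'
          rw [hz0, mul_zero]
        · have h1 := h a ha b hb (by
            rw [Finset.mem_insert, not_or]; exact ⟨hab', hab⟩)
          have e : (v a - v b) * (z a - z b) = (1 - c) * ((v a - v b) * (v a - v b)) +
            c * ((v a - v b) * (w a - w b)) := by simp only [hz]; ring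
          rw [e]
          exact add_nonneg (mul_nonneg hc1 (mul_self_nonneg _)) (mul_nonneg hc01.1 h1)
      have hzw : ∀ a ∈ s, ∀ b ∈ s, (a, b) ∉ P → 0 ≤ (z a - z b) * (w a - w b) := by
        intro a ha b hb hab
        by_cases hab' : (a, b) = (a₀, b₀)
        · obtain ⟨rfl, rfl⟩ := Prod.mk.inj hab'
          rw [hz0, zero_mul]
        · have h1 := h a ha b hb (by
            rw [Finset.mem_insert, not_or]; exact ⟨hab', hab⟩)
          have e : (z a - z b) * (w a - w b) = (1 - c) * ((v a - v b) * (w a - w b)) +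
            c * ((w a - w b) * (w a - w b)) := by simp only [hz]; ring
          rw [e]
          exact add_nonneg (mul_nonneg hc1 h1) (mul_nonneg hc01.1 (mul_self_nonneg _))
      have e1 : ∑ p ∈ s, |z p - v p| = c * ∑ p ∈ s, |w p - v p| := by
        rw [Finset.mul_sum]
        refine Finset.sum_congr rfl fun p _ => ?_
        rw [show z p - v p = c * (w p - v p) by simp only [hz]; ring, abs_mul, abs_of_nonneg hc01.1]
      have e2 : ∑ p ∈ s, |w p - z p| = (1 - c) * ∑ p ∈ s, |w p - v p| := by
        rw [Finset.mul_sum]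
        refine Finset.sum_congr rfl fun p _ => ?_
        rw [show w p - z p = (1 - c) * (w p - v p) by simp only [hz]; ring, abs_mul,
          abs_of_nonneg hc1]
      have hS : 0 ≤ ∑ p ∈ s, |w p - v p| := Finset.sum_nonneg fun _ _ => abs_nonneg _
      refine (ccDist_triangle _ (G z) _).trans ((add_le_add (ih v z hv hzb hvz)
        (ih z w hzb hw hzw)).trans_eq ?_)
      have hc0 := hc01.1
      rw [e1, e2, ← ENNReal.ofReal_add (by positivity) (by positivity)]
      congr 1
      ring

theorem exists_lipschitz_interp (n k : ℕ) {ε : ℝ} (hε : 0 < ε) (R : ℝ) :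
    ∃ ρ, 0 ≤ ρ ∧ ∀ (D : Anchor n k), D.Valid ε R → ∀ s : Finset (JetSpace n k), s.card ≤ n + 1 →
      (∀ a ∈ s, ∀ b ∈ s, ccDist a b ≤ ENNReal.ofReal ε) →
      ∀ v w : JetSpace n k → ℝ, IsBary s v → IsBary s w →
      ccDist (interp D v) (interp D w) ≤ ENNReal.ofReal (ρ * ∑ p ∈ s, |w p - v p|) := by
  obtain ⟨ρ, hρ, h⟩ := exists_lipschitz_of_isSorting n k hε R
  refine ⟨ρ, hρ, fun D hD s hs hd => ccDist_le_of_chambers hρ fun v w hv hw hvw => ?_⟩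
  obtain ⟨σ, hσv, hσw, hmem, hsum⟩ := exists_common_sorting hv hw hvw
  have := h D hD _ hs σ (fun l l' => hd _ (hmem l) _ (hmem l')) v w hσv hσw
    (by rw [hsum v]; exact hv.sum_eq) (by rw [hsum w]; exact hw.sum_eq)
  rwa [hsum fun p => |w p - v p|] at this

/-! ### Dilations -/

/-- The dilation as a bijection. -/
def dilationEquiv (L : ℝ) (hL : L ≠ 0) : JetSpace n k ≃ JetSpace n k where
  toFun := dilation L
  invFun := dilation L⁻¹
  left_inv p := by
    refine Prod.ext (funext fun i => ?_) (funext fun I => ?_)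
    · simp [dilation, hL]
    · simp [dilation, hL]
  right_inv p := by
    refine Prod.ext (funext fun i => ?_) (funext fun I => ?_)
    · simp [dilation, hL]
    · simp [dilation, hL]

theorem divMono_smul (I : Fin n → ℕ) (L : ℝ) (z : Fin n → ℝ) :
    divMono I 0 (L • z) = L ^ (∑ i, I i) * divMono I 0 z := by
  simp only [divMono, divPow, Pi.zero_apply, Nat.zero_le, if_true, Nat.sub_zero, Pi.smul_apply,
    smul_eq_mul, mul_pow, mul_div_assoc, Finset.prod_mul_distrib, Finset.prod_pow_eq_pow_sum]

theorem taylor_dilation {L : ℝ} (hL : L ≠ 0) (p : JetSpace n k) (y : Fin n → ℝ) :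
    taylor (dilation L p) y = L ^ (k + 1) * taylor p (L⁻¹ • y) := by
  have hy : y - (dilation L p).1 = L • (L⁻¹ • y - p.1) := by
    rw [smul_sub, smul_inv_smul₀ hL]; rfl
  rw [taylor, taylor, taylorDeriv, taylorDeriv, hy, Finset.mul_sum]
  refine Finset.sum_congr rfl fun I _ => ?_
  have hI : k + 1 = (k + 1 - I.order) + ∑ i, I.1 i := by
    have : ∑ i, I.1 i ≤ k := I.2
    simp only [MultiIndex.order]
    omega
  rw [divMono_smul]
  conv_rhs => rw [hI, pow_add]
  simp only [dilation]
  ring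

theorem blend_dilation {L : ℝ} (hL : L ≠ 0) {D D' : Anchor n k} {S S' : ℕ → Set (JetSpace n k)}
    (hscale : ∀ j, D'.scale (S' j) = L * D.scale (S j))
    (hrep : ∀ j, D'.rep (S' j) = dilation L (D.rep (S j))) (j : ℕ) :
    blend D' S' j = fun y => L ^ (k + 1) * blend D S j (L⁻¹ • y) := by
  induction j with
  | zero =>
    funext y
    rw [blend, blend, hrep, taylor_dilation hL]
  | succ j ih =>
    funext y
    have hc : cutoff D' (S' (j + 1)) j y = cutoff D (S (j + 1)) j (L⁻¹ • y) := by
      unfold cutoff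
      rw [hscale, hrep, div_mul_eq_div_div]
      congr 2
      unfold coord
      split_ifs
      · simp only [dilation, Pi.smul_apply, smul_eq_mul]
        field_simp
      · simp
    simp only [blend, ih, hc, hrep, taylor_dilation hL]
    ring

theorem jet_dilation {L : ℝ} (hL : L ≠ 0) {f : (Fin n → ℝ) → ℝ} (hf : ContDiff ℝ ∞ f)
    (y : Fin n → ℝ) :
    jet k (fun y => L ^ (k + 1) * f (L⁻¹ • y)) (L • y) = dilation L (jet k f y) := by
  refine Prod.ext rfl (funext fun I => ?_)
  simp only [jet, dilation, mpd, pdList_rescale hf, inv_smul_smul₀ hL, length_dirList]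
  have hI : k + 1 = (k + 1 - I.order) + ∑ i, I.1 i := by
    have : ∑ i, I.1 i ≤ k := I.2
    simp only [MultiIndex.order]
    omega
  conv_lhs => rw [hI, pow_add]
  rw [inv_pow, mul_assoc (L ^ (k + 1 - I.order)), mul_inv_cancel₀ (pow_ne_zero _ hL), mul_one]

/-- The interpolation commutes with the dilation if the anchors correspond to each other. -/
theorem interp_dilation {L : ℝ} (hL : L ≠ 0) {D D' : Anchor n k} {v v' : JetSpace n k → ℝ}
    (hv : ∀ p, v' (dilation L p) = v p)
    (hscale : ∀ j, D'.scale (dilation L '' levelSet v j) = L * D.scale (levelSet v j))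
    (hrep : ∀ j, D'.rep (dilation L '' levelSet v j) = dilation L (D.rep (levelSet v j))) :
    interp D' v' = dilation L (interp D v) := by
  have hve : v' ∘ dilationEquiv L hL = v := funext hv
  have hrank : ∀ j, rank v' j = rank v j := fun j => by
    rw [← rank_comp_equiv (dilationEquiv L hL), hve]
  have hset : ∀ j, levelSet v' j = dilation L '' levelSet v j := fun j => by
    rw [levelSet_comp_equiv (dilationEquiv L hL), hve]; rfl
  have hplace : place D' v' = L • place D v := by
    funext i
    simp only [place, Pi.smul_apply, smul_eq_mul, hset, hscale, hrank, mul_add]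
    congr 1
    · rw [← finsum_comp_equiv (dilationEquiv L hL), ← smul_eq_mul, smul_finsum]
      refine finsum_congr fun p => ?_
      change v' (dilation L p) * (L * p.1 i) = L * (v p * p.1 i)
      rw [hv]; ring
    · ring
  rw [interp, interp, hplace,
    blend_dilation hL (S := levelSet v) (D := D) (fun j => by rw [hset, hscale])
      (fun j => by rw [hset, hrep]), jet_dilation hL (contDiff_blend D _ n)]

/-- A member of a nonempty set of jets. -/
def pick (S : Set (JetSpace n k)) : JetSpace n k := Classical.epsilon fun p => p ∈ S

theorem pick_mem {S : Set (JetSpace n k)} (hS : S.Nonempty) : pick S ∈ S :=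
  Classical.epsilon_spec hS

open Classical in
/-- The anchor with constant scale `R`, except that the subsets of `δ_L(B)` get the dilates of
the scale and of the jets attached to the subsets of `B`. -/
def anchor (B : Set (JetSpace n k)) (L R : ℝ) : Anchor n k where
  scale S := if S ⊆ dilation L '' B then L * R else R
  rep S := if S ⊆ dilation L '' B then dilation L (pick (dilation L ⁻¹' S)) else pick S

theorem anchor_valid (B : Set (JetSpace n k)) {L ε : ℝ} (hL : 1 ≤ L) (hε : 0 < ε) :
    (anchor B L (4 * (ε + 1))).Valid ε (L * (4 * (ε + 1))) := by
  have h : 4 * (ε + 1) ≤ L * (4 * (ε + 1)) := le_mul_of_one_le_left (by positivity) hL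
  refine ⟨fun S => ?_, fun S => ?_, fun S hS => ?_⟩
  · simp only [anchor]; split_ifs <;> linarith
  · simp only [anchor]; split_ifs <;> linarith
  · simp only [anchor]
    split_ifs with hSB
    · refine pick_mem (S := dilation L ⁻¹' S) ?_
      obtain ⟨p, hp⟩ := hS
      obtain ⟨b, -, rfl⟩ := hSB hp
      exact ⟨b, hp⟩
    · exact pick_mem hS

theorem anchor_dilation {B B' S : Set (JetSpace n k)} {L R : ℝ} (hL : L ≠ 0) (hSB : S ⊆ B)
    (hS : ¬ S ⊆ dilation L '' B') :
    (anchor B L R).scale (dilation L '' S) = L * (anchor B' L R).scale S ∧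
    (anchor B L R).rep (dilation L '' S) = dilation L ((anchor B' L R).rep S) := by
  have h : dilation L '' S ⊆ dilation L '' B := image_mono hSB
  have hinj : Function.Injective (dilation L : JetSpace n k → JetSpace n k) :=
    (dilationEquiv L hL).injective
  simp [anchor, h, hS, preimage_image_eq S hinj]

/-! ### Points of the complex and their barycentric coordinates -/

open Classical in
/-- The coordinates of a vector of `l²(Γ)`, extended by `0` to all jets. -/
def coords {Γ : Set (JetSpace n k)} (v : L2 Γ) (p : JetSpace n k) : ℝ :=
  if h : p ∈ Γ then v ⟨p, h⟩ else 0

open Classical in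
theorem coords_vertex {Γ : Set (JetSpace n k)} (c : Γ) (p : JetSpace n k) :
    coords (vertex c) p = if p = c.1 then 1 else 0 := by
  unfold coords vertex
  by_cases h : p ∈ Γ
  · rw [dif_pos h, lp.single_apply, Pi.single_apply]
    simp [Subtype.ext_iff]
  · rw [dif_neg h, if_neg]
    rintro rfl
    exact h c.2

theorem coords_add {Γ : Set (JetSpace n k)} (v w : L2 Γ) (p : JetSpace n k) :
    coords (v + w) p = coords v p + coords w p := by
  unfold coords
  split_ifs <;> simp

theorem coords_smul {Γ : Set (JetSpace n k)} (c : ℝ) (v : L2 Γ) (p : JetSpace n k) :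
    coords (c • v) p = c * coords v p := by
  unfold coords
  split_ifs <;> simp

theorem coords_sum {Γ : Set (JetSpace n k)} {ι : Type*} (s : Finset ι) (v : ι → L2 Γ)
    (p : JetSpace n k) : coords (∑ i ∈ s, v i) p = ∑ i ∈ s, coords (v i) p := by
  classical
  induction s using Finset.induction_on with
  | empty => simp [coords]
  | insert i s hi ih => rw [Finset.sum_insert hi, Finset.sum_insert hi, coords_add, ih]

theorem abs_coords_sub_le {Γ : Set (JetSpace n k)} (v w : L2 Γ) (p : JetSpace n k) :
    |coords w p - coords v p| ≤ dist v w := by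
  unfold coords
  split_ifs with h
  · rw [dist_comm, dist_eq_norm]
    exact lp.norm_apply_le_norm two_ne_zero (w - v) ⟨p, h⟩
  · simp

theorem isBary_coords {Γ : Set (JetSpace n k)} {s : Finset Γ} {v : L2 Γ}
    (hv : v ∈ convexHull ℝ (vertex '' (s : Set Γ))) :
    IsBary (s.map (Function.Embedding.subtype _)) (coords v) := by
  classical
  refine convexHull_min (t := {v : L2 Γ | IsBary (s.map (Function.Embedding.subtype _)) (coords v)})
    ?_ ?_ hv
  · rintro _ ⟨c, hc, rfl⟩
    refine ⟨fun p => ?_, fun p hp => ?_, ?_⟩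
    · rw [coords_vertex]; split_ifs <;> norm_num
    · rw [coords_vertex, if_neg]
      rintro rfl
      exact hp (Finset.mem_map_of_mem _ hc)
    · simp only [coords_vertex]
      rw [Finset.sum_ite_eq']
      exact if_pos (Finset.mem_map_of_mem (Function.Embedding.subtype _) hc)
  · intro v hv w hw a b ha hb hab
    have h := IsBary.lineMap hv hw (c := b) ⟨hb, by linarith⟩
    have e : coords (a • v + b • w) = fun p => (1 - b) * coords v p + b * coords w p := by
      funext p
      rw [coords_add, coords_smul, coords_smul, ← hab, add_sub_cancel_right]
    rw [← e] at h
    exact h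

theorem interp_vertex {Γ : Set (JetSpace n k)} {D : Anchor n k} {ε R : ℝ} (hε : 0 < ε)
    (hD : D.Valid ε R) (c : Γ) : interp D (coords (vertex c)) = c.1 := by
  classical
  let σ : Fin 1 → JetSpace n k := fun _ => c.1
  have hσ : IsSorting σ (coords (vertex c)) := by
    refine ⟨Function.injective_of_subsingleton _, fun p => ?_, fun p hp => ?_, fun i j _ => ?_⟩
    · rw [coords_vertex]; split_ifs <;> norm_num
    · rw [coords_vertex, if_neg]
      rintro rfl
      exact hp ⟨0, rfl⟩
    · rw [Subsingleton.elim i j]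
  have hrep : ∀ j, D.rep (initSet σ j) = c.1 := by
    intro j
    obtain ⟨l, hl⟩ := initSet_subset σ j (hD.rep_mem _ (initSet_nonempty σ one_pos j))
    exact hl.symm
  have hplace : placeOn D σ (coords (vertex c)) = c.1.1 := by
    funext i
    simp [placeOn, valAt, σ, coords_vertex]
  have hblend : ∀ j, blend D (initSet σ) j = taylor c.1 := by
    intro j
    induction j with
    | zero => rw [blend, hrep]
    | succ j ih => funext y; simp [blend, hrep, ih]
  rw [hσ.interp_eq (by omega) (by simp [σ, coords_vertex]) hε hD (by simp [σ, ccDist_self]),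
    hplace, hblend, jet_taylor_self]

theorem intertwines_interp {B B' Γ Γ' : Set (JetSpace n k)} {L R ε : ℝ} (hL : L ≠ 0)
    (hΓ : B ⊆ Γ) (hΓ' : dilation L '' B ⊆ Γ') (hB : Disjoint B (dilation L '' B')) (N : ℕ) :
    Intertwines L ε N hΓ hΓ' (fun v => interp (anchor B' L R) (coords v))
      (fun v => interp (anchor B L R) (coords v)) := by
  classical
  intro m _ b _ t ht
  have hinj : Function.Injective (dilation L : JetSpace n k → JetSpace n k) :=
    (dilationEquiv L hL).injective
  set v : L2 Γ := ∑ i, t i • vertex ⟨(b i).1, hΓ (b i).2⟩ with hv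
  have hcv : ∀ p, coords v p = ∑ i, t i * if p = (b i).1 then 1 else 0 := fun p => by
    rw [hv, coords_sum]
    simp only [coords_smul, coords_vertex]
  have hsupp : ∀ p, coords v p ≠ 0 → p ∈ range fun i => (b i).1 := by
    intro p hp
    by_contra hp'
    refine hp ((hcv p).trans (Finset.sum_eq_zero fun i _ => ?_))
    rw [if_neg (fun h => hp' ⟨i, h.symm⟩), mul_zero]
  have hsub : ∀ j, levelSet (coords v) j ⊆ B := by
    intro j p hp
    obtain ⟨i, rfl⟩ := hsupp p hp.1.ne'
    exact (b i).2
  have hne : ∀ j, (levelSet (coords v) j).Nonempty := by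
    obtain ⟨i, hi⟩ : ∃ i, 0 < t i := by
      by_contra! hcon
      have h0 : ∑ i, t i = 0 := Finset.sum_eq_zero fun i _ => le_antisymm (hcon i) (ht.1 i)
      linarith [ht.2]
    have hpos : 0 < coords v (b i).1 := by
      rw [hcv]
      refine hi.trans_le ?_
      have := Finset.single_le_sum (f := fun l => t l * if (b i).1 = (b l).1 then (1 : ℝ) else 0)
        (fun l _ => mul_nonneg (ht.1 l) (by split_ifs <;> norm_num)) (Finset.mem_univ i)
      simpa using this
    exact fun j => levelSet_nonempty ((finite_range _).subset fun p hp => hsupp p hp) hpos j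
  have hnot : ∀ j, ¬ levelSet (coords v) j ⊆ dilation L '' B' := by
    intro j hj
    obtain ⟨p, hp⟩ := hne j
    exact disjoint_left.1 hB (hsub j hp) (hj hp)
  refine interp_dilation hL (fun p => ?_) (fun j => (anchor_dilation hL (hsub j) (hnot j)).1)
    (fun j => (anchor_dilation hL (hsub j) (hnot j)).2)
  rw [hcv, coords_sum]
  simp only [coords_smul, coords_vertex, hinj.eq_iff]

theorem exists_lipschitzOnSimplices (n k : ℕ) {ε : ℝ} (hε : 0 < ε) (R : ℝ) :
    ∃ ϱ : ℝ≥0, ∀ (Γ : Set (JetSpace n k)) (D : Anchor n k), D.Valid ε R →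
      LipschitzOnSimplices (Γ := Γ) ϱ ε n fun v => interp D (coords v) := by
  obtain ⟨ρ, hρ, h⟩ := exists_lipschitz_interp n k hε R
  refine ⟨Real.toNNReal (ρ * (n + 1)), fun Γ D hD S hS v hv w hw => ?_⟩
  obtain ⟨s, -, hcard, hdist, rfl⟩ := hS
  refine (h D hD (s.map (Function.Embedding.subtype _)) (by simpa using hcard) ?_ _ _
    (isBary_coords hv) (isBary_coords hw)).trans ?_
  · intro a ha b hb
    obtain ⟨a, has, rfl⟩ := Finset.mem_map.1 ha
    obtain ⟨b, hbs, rfl⟩ := Finset.mem_map.1 hb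
    exact hdist a has b hbs
  · rw [edist_dist]
    change _ ≤ ENNReal.ofReal (ρ * (n + 1)) * ENNReal.ofReal (dist v w)
    rw [← ENNReal.ofReal_mul (by positivity)]
    refine ENNReal.ofReal_le_ofReal ?_
    rw [mul_assoc]
    refine mul_le_mul_of_nonneg_left ?_ hρ
    refine (Finset.sum_le_card_nsmul _ _ _ fun p _ => abs_coords_sub_le v w p).trans ?_
    rw [Finset.card_map, nsmul_eq_mul]
    refine mul_le_mul_of_nonneg_right ?_ dist_nonneg
    exact_mod_cast hcard

end JetCarnot

end

open JetCarnot
/-- The maps `F` and `F'` are given on all of `l²(Γ)` and `l²(Γ')`, but only their values on the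
complexes `Σ(Γ, ε, n)` and `Σ(Γ', ε, n)` matter. -/
theorem proposition3p1 (k n r : ℕ) (hk : 1 ≤ k) (hn : 1 ≤ n) (hr : 2 ≤ r)
    (ε ε' : ℝ) (hε' : 0 < ε') (hε : ε' ≤ ε) :
    ∃ A A' : Set (JetSpace n k),
      IsDiscreteSubset A ∧ IsDiscreteSubset A' ∧ IsEpsDense ε' A ∧ IsEpsDense ε' A' ∧
      ∃ (F : L2 (A ∪ dilation (r : ℝ) '' A') → JetSpace n k)
        (F' : L2 (A' ∪ dilation (r : ℝ) '' A) → JetSpace n k),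
        (∀ c, F (vertex c) = c.1) ∧
        (∀ c', F' (vertex c') = c'.1) ∧
        Intertwines (B := A) (r : ℝ) ε n Set.subset_union_left Set.subset_union_right F F' ∧
        Intertwines (B := A') (r : ℝ) ε n Set.subset_union_left Set.subset_union_right F' F ∧
        ∃ ϱ : ℝ≥0, LipschitzOnSimplices ϱ ε n F ∧ LipschitzOnSimplices ϱ ε n F' := by
  have hr1 : (1 : ℝ) ≤ r := by exact_mod_cast (by omega : 1 ≤ r)
  have hr0 : (r : ℝ) ≠ 0 := by positivity
  have hε0 : 0 < ε := hε'.trans_le hε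
  let i₀ : Fin n := ⟨0, hn⟩
  -- The first coordinates are rational on `A` and irrational on `A'`, and the dilation by the
  -- integer `r` preserves this, so that `A` and `δ_r(A')`, as well as `A'` and `δ_r(A)`, are
  -- disjoint.
  obtain ⟨A, hAQ, hA, hAε⟩ := exists_net hε'
    (exists_near_of_dense (k := k) i₀ Rat.denseRange_cast (half_pos hε'))
  obtain ⟨A', hAQ', hA', hAε'⟩ := exists_net hε'
    (exists_near_of_dense (k := k) i₀ dense_irrational (half_pos hε'))
  have hdisj : Disjoint A (dilation (r : ℝ) '' A') := by
    rw [Set.disjoint_left]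
    rintro _ ha ⟨a', ha', rfl⟩
    obtain ⟨q, hq⟩ := hAQ ha
    refine hAQ' ha' ⟨q / r, ?_⟩
    have hq : (q : ℝ) = r * a'.1 i₀ := hq
    push_cast
    rw [hq]
    field_simp
  have hdisj' : Disjoint A' (dilation (r : ℝ) '' A) := by
    rw [Set.disjoint_left]
    rintro _ ha' ⟨a, ha, rfl⟩
    obtain ⟨q, hq⟩ := hAQ ha
    refine hAQ' ha' ⟨r * q, ?_⟩
    have hq : (q : ℝ) = a.1 i₀ := hq
    push_cast
    rw [hq]
    rfl
  obtain ⟨ϱ, hϱ⟩ := exists_lipschitzOnSimplices n k hε0 (r * (4 * (ε + 1)))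
  have hD := anchor_valid A' hr1 hε0
  have hD' := anchor_valid A hr1 hε0
  exact ⟨A, A', hA, hA', hAε, hAε', fun v => interp (anchor A' r (4 * (ε + 1))) (coords v),
    fun v => interp (anchor A r (4 * (ε + 1))) (coords v),
    fun c => interp_vertex hε0 hD c, fun c => interp_vertex hε0 hD' c,
    intertwines_interp hr0 _ _ hdisj n, intertwines_interp hr0 _ _ hdisj' n,
    ϱ, hϱ _ _ hD, hϱ _ _ hD'⟩
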